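/- Let $\mathcal V$ be the set of finite words over $\mathbf N=\{1,2,\dots\}$, $\phi$ the empty word, and let $\mathcal T$ be the tree on $\mathcal V$ with edges $\{v,v.i\}$, $v\in\mathcal V$, $i\in\mathbf N$. Let $(\xi^v_1<\xi^v_2<\cdots)_{v\in\mathcal V}$ be independent Poisson processes of intensity $1$ on $\mathbf R_+$, and give the edge $\{v,v.i\}$ the length $\xi(v,v.i)=\xi(v.i,v)=\xi^v_i$ (the Poisson weighted infinite tree, PWIT). Let $W$ be the inverse of $x\mapsto xe^x$ on $\mathbf R_+$, and $\overline F_*(y)=W(1)e^{-y}$ for $y\ge 0$, $\overline F_*(y)=1$ for $y<0$, the complementary distribution function of a law $F_*$. A stationary process on $\mathcal T$ is a family of random variables $X(u,v)$, indexed by the directed edges of $\mathcal T$ and defined on the same probability space as the PWIT, such that (a) almost surely $X(u,v)=\min\{(\xi(v,w)-X(v,w))^+ : w\sim v,\ w\ne u\}$ for every directed edge $(u,v)$; (b) $X(v,v.i)$ has distribution $F_*$ for all $v\in\mathcal V$, $i\in\mathbf N$; (c) $X(u,v)$ and $X(v,u)$ are independent for every edge $\{u,v\}$; (d) conditionally on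 there being an edge $\{\phi,v_z\}$ of length $z$ at the root, $X(\phi,v_z)$ and $X(v_z,\phi)$ are independent with distribution $F_*$; that is, for all Borel $B\subset(0,\infty)$ and $x,y\in\mathbf R$, $\sum_{i\ge1}\mathbf P\{\xi^\phi_i\in B,\ X(\phi,i)>x,\ X(i,\phi)>y\}=|B|\,\overline F_*(x)\,\overline F_*(y)$. For initial messages $X^0_{\mathcal T}(v,v.i)$ on the edges directed away from the root, let the belief propagation messages be $$X^{k+1}_{\mathcal T}(u,v)=\min_{w\sim v,\,w\neq u}\bigl(\xi(v,w)-X^k_{\mathcal T}(v,w)\bigr)^+ ,\qquad k\ge0,$$ so that those directed away from the root depend only on the initial messages directed away from the root. Let $$\pi^k_{\mathcal T}(\phi)=\operatorname*{arg\,min}_{u\sim\phi}\bigl(\xi(\phi,u)-X^k_{\mathcal T}(\phi,u)\bigr)^+,\qquad \mathcal C_{\mathrm{opt}}(\phi)=\operatorname*{arg\,min}_{u\sim\phi}\bigl(\xi(\phi,u)-X(\phi,u)\bigr)^+$$ be the sets of all minimizers. Theorem. On any probability space carrying a PWIT there is a stationary process $X$, and it is unique: any two stationary processes on this space agree almost surely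 on every directed edge. Moreover, if the initial messages $X^0_{\mathcal T}(v,v.i)$, $v\in\mathcal V$, $i\in\mathbf N$, are i.i.d. with an arbitrary distribution on $\mathbf R_+$ and independent of the edge lengths, then for all $v\in\mathcal V$ and $i\in\mathbf N$ $$X^k_{\mathcal T}(v,v.i)\xrightarrow{L^2}X(v,v.i)\qquad\text{as }k\to\infty,$$ where $X(v,v.i)$ and $X^k_{\mathcal T}(v,v.i)$, $k\ge1$, are square integrable, and $$\mathbf P\{\pi^k_{\mathcal T}(\phi)\ne\mathcal C_{\mathrm{opt}}(\phi)\}\to0\qquad\text{as }k\to\infty.$$ -/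

import Mathlib

open MeasureTheory ProbabilityTheory Filter Topology

namespace EdgeCoverBP

noncomputable section

/-! ## Belief propagation for edge cover on a graph with edge costs -/

/-- The update rule: the new message from `v` to `w` is the minimum over the neighbours
`u ≠ w` of `v` of `(cost v u - m v u)⁺`. The value `m w v` is the message `X (w, v)`. -/
def bpUpdate {V : Type*} (G : SimpleGraph V) (cost m : V → V → ℝ) (w v : V) : ℝ :=
  ⨅ u : {u : V // G.Adj v u ∧ u ≠ w}, max (cost v u - m v u) 0

/-- The messages after `k` iterations, started from the initial messages `m₀`. -/
def bpMessage {V : Type*} (G : SimpleGraph V) (cost m₀ : V → V → ℝ) : ℕ → V → V → ℝ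
  | 0 => m₀
  | k + 1 => bpUpdate G cost (bpMessage G cost m₀ k)

/-- The decision rule at `v`: the set of all neighbours `u` of `v` that minimize
`(cost v u - m v u)⁺`. -/
def argminNeighbors {V : Type*} (G : SimpleGraph V) (cost m : V → V → ℝ) (v : V) : Set V :=
  {u | G.Adj v u ∧ ∀ u', G.Adj v u' → max (cost v u - m v u) 0 ≤ max (cost v u' - m v u') 0}

/-! ## The Poisson weighted infinite tree -/

/-- Vertices: finite words over a countably infinite alphabet. A word is stored with its last
letter first, so that `i :: v` is the word `v.i` (the `i`-th child of `v`, counted from `0`),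
and `[]` is the root. -/
abbrev Word : Type := List ℕ

/-- The tree on the words, with the edges `{v, v.i}`. -/
def wordTree : SimpleGraph Word where
  Adj u v := (∃ i, v = i :: u) ∨ (∃ i, u = i :: v)
  symm := ⟨fun _ _ h => h.symm⟩
  loopless := ⟨fun u h => by
    rcases h with ⟨i, hi⟩ | ⟨i, hi⟩ <;> simpa using congrArg List.length hi⟩

/-- The length of the edge joining a word to its parent, if the edge `{v, v.i}` has
length `ξ v i`. -/
def parentEdgeLength (ξ : Word → ℕ → ℝ) : Word → ℝ
  | [] => 0
  | i :: v => ξ v i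

/-- The symmetric length function on the edges: `{v, v.i}` has length `ξ v i`
(irrelevant value on pairs that are not edges). -/
def edgeLength (ξ : Word → ℕ → ℝ) (u v : Word) : ℝ :=
  if u.length < v.length then parentEdgeLength ξ v else parentEdgeLength ξ u

lemma edgeLength_child (ξ : Word → ℕ → ℝ) (v : Word) (i : ℕ) :
    edgeLength ξ v (i :: v) = ξ v i ∧ edgeLength ξ (i :: v) v = ξ v i := by
  simp [edgeLength, parentEdgeLength]

variable {Ω : Type*} [MeasurableSpace Ω]

/-- The gap of a sequence of points before its `i`-th point (the first gap starts at `0`). -/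
def gap (τ : ℕ → Ω → ℝ) : ℕ → Ω → ℝ
  | 0 => τ 0
  | i + 1 => fun ω => τ (i + 1) ω - τ i ω

/-- `τ 0 < τ 1 < ⋯` are the points, in increasing order, of a Poisson process of intensity `1`
on `[0, ∞)`: the gaps are independent exponential variables with mean `1`. -/
structure IsPoissonProcess (P : Measure Ω) (τ : ℕ → Ω → ℝ) : Prop where
  measurable : ∀ i, Measurable (τ i)
  map_gap : ∀ i, P.map (gap τ i) = expMeasure 1
  indep_gap : iIndepFun (gap τ) P

/-- `ξ` gives the edge lengths of a Poisson weighted infinite tree: the sequences `ξ v`, for `v`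
a word, are independent Poisson processes of intensity `1`. -/
structure IsPWIT (P : Measure Ω) (ξ : Word → ℕ → Ω → ℝ) : Prop where
  poisson : ∀ v, IsPoissonProcess P (ξ v)
  indep : iIndepFun (fun v ω i => ξ v i ω) P

/-- The (random) edge lengths at the sample point `ω`. -/
def pwitLength (ξ : Word → ℕ → Ω → ℝ) (ω : Ω) : Word → Word → ℝ :=
  edgeLength fun v i => ξ v i ω

/-- The BP messages on the PWIT after `k` iterations, from the initial messages `X₀`. -/
def pwitMessage (ξ : Word → ℕ → Ω → ℝ) (X₀ : Word → Word → Ω → ℝ) (k : ℕ)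
    (u v : Word) (ω : Ω) : ℝ :=
  bpMessage wordTree (pwitLength ξ ω) (fun a b => X₀ a b ω) k u v

/-- The decision `π^k(v)` of BP on the PWIT after `k` iterations. -/
def pwitDecision (ξ : Word → ℕ → Ω → ℝ) (X₀ : Word → Word → Ω → ℝ) (k : ℕ)
    (v : Word) (ω : Ω) : Set Word :=
  argminNeighbors wordTree (pwitLength ξ ω) (fun a b => pwitMessage ξ X₀ k a b ω) v

/-! ## The stationary process -/

/-- Lambert's function, the inverse of `x ↦ x * exp x` on `[0, ∞)`. -/
def lambertW (y : ℝ) : ℝ :=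
  Function.invFunOn (fun x : ℝ => x * Real.exp x) (Set.Ici 0) y

lemma lambertW_spec {y : ℝ} (hy : 0 ≤ y) :
    0 ≤ lambertW y ∧ lambertW y * Real.exp (lambertW y) = y := by
  have h : ∃ x ∈ Set.Ici (0 : ℝ), (fun x : ℝ => x * Real.exp x) x = y := by
    have hc : ContinuousOn (fun x : ℝ => x * Real.exp x) (Set.Icc 0 y) := by fun_prop
    obtain ⟨x, hx, hxy⟩ := intermediate_value_Icc hy hc
      (show y ∈ Set.Icc _ _ from ⟨by simpa using hy, by
        have := Real.add_one_le_exp y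
        show y ≤ y * Real.exp y
        nlinarith⟩)
    exact ⟨x, hx.1, hxy⟩
  exact ⟨Function.invFunOn_mem h, Function.invFunOn_eq h⟩

/-- The complementary distribution function of the fixed-point distribution `F_*`. -/
def fixedTail (y : ℝ) : ℝ :=
  if 0 ≤ y then lambertW 1 * Real.exp (-y) else 1

/-- `X` is a stationary process on the directed edges of the PWIT with edge lengths `ξ`. -/
structure IsStationaryProcess (P : Measure Ω) (ξ : Word → ℕ → Ω → ℝ)
    (X : Word → Word → Ω → ℝ) : Prop where
  aemeasurable : ∀ u v, wordTree.Adj u v → AEMeasurable (X u v) P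
  /-- The recursion holds on every directed edge. -/
  recursion : ∀ u v, wordTree.Adj u v → ∀ᵐ ω ∂P,
    X u v ω = bpUpdate wordTree (pwitLength ξ ω) (fun a b => X a b ω) u v
  /-- On edges directed away from the root, the distribution is `F_*`. -/
  tail : ∀ (v : Word) (i : ℕ) (y : ℝ),
    P {ω | y < X v (i :: v) ω} = ENNReal.ofReal (fixedTail y)
  /-- The variables on the two directions of an edge are independent. -/
  indep : ∀ u v, wordTree.Adj u v → IndepFun (X u v) (X v u) P
  /-- Conditionally on the presence of an edge of length `z` at the root, the variables on its
  two directions are independent with distribution `F_*`. The conditioning is that of Palm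
  distributions: the lengths of the root edges have intensity `dz` on `(0, ∞)`, and the formula
  disintegrates with respect to it. -/
  palm : ∀ B : Set ℝ, MeasurableSet B → ∀ x y : ℝ,
    ∑' i : ℕ, P {ω | ξ [] i ω ∈ B ∧ x < X [] [i] ω ∧ y < X [i] [] ω} =
      volume (B ∩ Set.Ioi 0) * (ENNReal.ofReal (fixedTail x) * ENNReal.ofReal (fixedTail y))

/-- `C_opt(v)`: the neighbours `y` of `v` minimizing `(ξ (v, y) - X (v, y))⁺`. -/
def coptAt (ξ : Word → ℕ → Ω → ℝ) (X : Word → Word → Ω → ℝ) (v : Word) (ω : Ω) : Set Word :=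
  argminNeighbors wordTree (pwitLength ξ ω) (fun a b => X a b ω) v

/-- The initial messages on the edges directed away from the root are i.i.d. with law `ν` and
independent of the edge lengths. The messages towards the root never influence those directed
away from it, and their initial values are unrestricted. -/
structure IsIIDInit (P : Measure Ω) (ξ : Word → ℕ → Ω → ℝ) (ν : Measure ℝ)
    (X₀ : Word → Word → Ω → ℝ) : Prop where
  measurable : ∀ (v : Word) (i : ℕ), Measurable (X₀ v (i :: v))
  map_eq : ∀ (v : Word) (i : ℕ), P.map (X₀ v (i :: v)) = ν
  indep : iIndepFun (fun (e : Word × ℕ) => X₀ e.1 (e.2 :: e.1)) P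
  indep_tree : IndepFun (fun ω (e : Word × ℕ) => ξ e.1 e.2 ω)
    (fun ω (e : Word × ℕ) => X₀ e.1 (e.2 :: e.1) ω) P

end

end EdgeCoverBP

open EdgeCoverBP

/-!
The update of belief propagation is antitone in the messages. On the edges directed away from the
root, the messages `zeroIter` started from `0` therefore alternate: the even iterates increase, the
odd iterates decrease, and every even iterate lies below every odd one. Messages started from any
nonnegative values, and any solution of the recursion, are trapped between consecutive iterates
(`IsDownRecursion.zeroIter_even_le`, `IsDownRecursion.le_zeroIter_odd`). So everything follows once
the gap closes (`IsPWIT.ae_isSqueezed`): the common limit is a function of the edge lengths, it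
solves the recursion, it is the only solution, and it attracts all nonnegative initial messages.

The gap closes because the laws can be computed. The points of a Poisson process with independent
marks `A j` of law `messageLaw c`, i.e. `(1 - c) δ₀ + c Exp(1)`, satisfy
`P (y < min_j (τ j - A j)⁺) = exp (-c) * exp (-y)` for `y ≥ 0`, so the minimum has law
`messageLaw (exp (-c))` (`IsPoissonProcess.map_iInf_eq_messageLaw`). Iterating `c ↦ exp (-c)` from
`0` converges to its fixed point `W(1)`. The even and odd limits are ordered and have the same law,
hence agree almost surely, with law `F_*`.

The void probability above, and the Palm formula at the root, come from the Markov property of the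
points (`IsPoissonProcess.lintegral_mul_point`): a function `Φ` invariant under the walk with
exponential steps killed with survival probability `g` turns the products of `g` over the points
into a martingale (`IsPoissonProcess.tendsto_lintegral_prod_Ico`), and Tonelli's theorem yields the
invariance needed for the Campbell–Mecke formula (`IsPoissonProcess.tsum_lintegral_prod_range`).

The convergence in `L²` is dominated by the first iterate, which is exponential. For the decisions
at the root, the slacks `ξ j - X j` dominate a sequence tending to infinity and have no ties, so
that the set of minimizers is eventually determined by finitely many strict inequalities
(`eventually_argmin_iff`).
-/

open MeasureTheory ProbabilityTheory Filter Topology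
open scoped ENNReal

namespace EdgeCoverBP

/-! ### Blocks of independent σ-algebras -/

lemma iIndep_biSup_of_pairwise_disjoint {Ω ι κ : Type*} [mΩ : MeasurableSpace Ω]
    {P : Measure Ω} {m : ι → MeasurableSpace Ω} (hle : ∀ i, m i ≤ mΩ) (hm : iIndep m P)
    {S : κ → Set ι} (hS : Pairwise fun a b => Disjoint (S a) (S b)) :
    iIndep (fun a => ⨆ i ∈ S a, m i) P := by
  classical
  have := hm.isProbabilityMeasure
  rw [iIndep_iff]
  intro s
  induction s using Finset.induction_on with
  | empty => intro f _; simp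
  | insert a s ha ih =>
    intro f hf
    rw [Finset.prod_insert ha, Finset.set_biInter_insert,
      ← ih fun i hi => hf i (Finset.mem_insert_of_mem hi)]
    have hd : Disjoint (S a) (⋃ b ∈ s, S b) := by
      simp only [Set.disjoint_iUnion_right]
      exact fun b hb => hS (fun h => ha (h ▸ hb))
    refine (Indep_iff _ _ _).1 (indep_iSup_of_disjoint hle hm hd) _ _
      (hf a (Finset.mem_insert_self _ _)) ?_
    refine Finset.measurableSet_biInter _ fun b hb => ?_
    have hsub : (⨆ i ∈ S b, m i) ≤ ⨆ i ∈ ⋃ b ∈ s, S b, m i :=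
      biSup_mono fun i hi => Set.mem_biUnion hb hi
    exact hsub _ (hf b (Finset.mem_insert_of_mem hb))

/-! ### The Markov property of a Poisson process -/

/-- One step of a random walk with exponential increments of mean `1`, acting on functions. -/
noncomputable def expStep (φ : ℝ → ℝ≥0∞) (s : ℝ) : ℝ≥0∞ := ∫⁻ t, φ (s + t) ∂(expMeasure 1)

instance : IsProbabilityMeasure (expMeasure 1) := isProbabilityMeasure_expMeasure one_pos

lemma lintegral_expMeasure_one (φ : ℝ → ℝ≥0∞) (hφ : Measurable φ) :
    ∫⁻ t, φ t ∂(expMeasure 1) = ∫⁻ t in Set.Ioi 0, ENNReal.ofReal (Real.exp (-t)) * φ t := by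
  have h1 : expMeasure 1 = volume.withDensity (exponentialPDF 1) := rfl
  have h2 : Measurable (exponentialPDF 1) := (measurable_exponentialPDFReal 1).ennreal_ofReal
  rw [h1, lintegral_withDensity_eq_lintegral_mul _ h2 hφ,
    ← setLIntegral_congr (Ioi_ae_eq_Ici (a := (0 : ℝ))).symm,
    ← lintegral_indicator measurableSet_Ici]
  refine lintegral_congr fun t => ?_
  by_cases ht : 0 ≤ t
  · simp [exponentialPDF_of_nonneg ht, Set.indicator_of_mem (Set.mem_Ici.2 ht)]
  · simp [exponentialPDF_of_neg (not_le.1 ht), ht]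

lemma expStep_eq (φ : ℝ → ℝ≥0∞) (hφ : Measurable φ) (s : ℝ) :
    expStep φ s = ∫⁻ u in Set.Ioi s, ENNReal.ofReal (Real.exp (s - u)) * φ u := by
  rw [expStep, lintegral_expMeasure_one (fun t => φ (s + t)) (by fun_prop)]
  have h := (measurePreserving_add_left volume s).setLIntegral_comp_preimage
    (s := Set.Ioi s) measurableSet_Ioi
    (f := fun u => ENNReal.ofReal (Real.exp (s - u)) * φ u) (by fun_prop)
  rw [← h]
  have hpre : (fun x => s + x) ⁻¹' Set.Ioi s = Set.Ioi 0 := by ext x; simp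
  simp [hpre]

section gaps

variable {Ω : Type*}

/-- The point before the `n`-th point of a sequence, with the convention that the point before
the first one is `0`. -/
def prevPoint (τ : ℕ → Ω → ℝ) : ℕ → Ω → ℝ
  | 0 => fun _ => 0
  | n + 1 => τ n

/-- The σ-algebra generated by the first `n` gaps. -/
abbrev past (τ : ℕ → Ω → ℝ) (n : ℕ) : MeasurableSpace Ω :=
  ⨆ i ∈ Set.Iio n, MeasurableSpace.comap (gap τ i) inferInstance

lemma prevPoint_add_gap (τ : ℕ → Ω → ℝ) (n : ℕ) (ω : Ω) :
    prevPoint τ n ω + gap τ n ω = τ n ω := by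
  cases n <;> simp [prevPoint, gap]

lemma past_mono (τ : ℕ → Ω → ℝ) {m n : ℕ} (h : m ≤ n) : past τ m ≤ past τ n :=
  biSup_mono fun _ hi => lt_of_lt_of_le hi h

lemma measurable_past_gap (τ : ℕ → Ω → ℝ) {i n : ℕ} (h : i < n) :
    Measurable[past τ n] (gap τ i) :=
  (comap_measurable (gap τ i)).mono
    (le_biSup (fun i => MeasurableSpace.comap (gap τ i) inferInstance) h) le_rfl

lemma measurable_past_prevPoint (τ : ℕ → Ω → ℝ) (n : ℕ) :
    Measurable[past τ n] (prevPoint τ n) := by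
  induction n with
  | zero => exact measurable_const
  | succ n ih =>
    have h : prevPoint τ (n + 1) = fun ω => prevPoint τ n ω + gap τ n ω :=
      funext fun ω => (prevPoint_add_gap τ n ω).symm
    rw [h]
    exact (ih.mono (past_mono τ n.le_succ) le_rfl).add (measurable_past_gap τ n.lt_succ_self)

lemma measurable_past_point (τ : ℕ → Ω → ℝ) {i n : ℕ} (h : i < n) :
    Measurable[past τ n] (τ i) :=
  (measurable_past_prevPoint τ (i + 1)).mono (past_mono τ h) le_rfl

namespace IsPoissonProcess

variable [MeasurableSpace Ω] {P : Measure Ω} {τ : ℕ → Ω → ℝ} (hτ : IsPoissonProcess P τ)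
include hτ

lemma measurable_gap (n : ℕ) : Measurable (gap τ n) := by
  cases n with
  | zero => exact hτ.measurable 0
  | succ n => exact (hτ.measurable _).sub (hτ.measurable _)

lemma past_le (n : ℕ) : past τ n ≤ ‹MeasurableSpace Ω› :=
  iSup₂_le fun i _ => (hτ.measurable_gap i).comap_le

lemma measurable_prevPoint (n : ℕ) : Measurable (prevPoint τ n) :=
  (measurable_past_prevPoint τ n).mono (hτ.past_le n) le_rfl

lemma indepFun_gap_of_past {β : Type*} [MeasurableSpace β] {n : ℕ} {V : Ω → β}
    (hV : Measurable[past τ n] V) : IndepFun V (gap τ n) P := by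
  have h := indep_iSup_of_disjoint (fun i => (hτ.measurable_gap i).comap_le) hτ.indep_gap
    (S := Set.Iio n) (T := {n}) (by simp)
  refine indep_of_indep_of_le_left (indep_of_indep_of_le_right h ?_) hV.comap_le
  simp

/-- The Markov property: given the first `n` gaps, the next point has the law of the previous one
plus an independent exponential variable. -/
lemma lintegral_mul_point [IsProbabilityMeasure P] {n : ℕ} {H : Ω → ℝ≥0∞}
    (hH : Measurable[past τ n] H) {φ : ℝ → ℝ≥0∞} (hφ : Measurable φ) :
    ∫⁻ ω, H ω * φ (τ n ω) ∂P = ∫⁻ ω, H ω * expStep φ (prevPoint τ n ω) ∂P := by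
  have hV : Measurable[past τ n] fun ω => (H ω, prevPoint τ n ω) :=
    hH.prodMk (measurable_past_prevPoint τ n)
  have hV' := hV.mono (hτ.past_le n) le_rfl
  have hmap := (indepFun_iff_map_prod_eq_prod_map_map hV'.aemeasurable
    (hτ.measurable_gap n).aemeasurable).1 (hτ.indepFun_gap_of_past hV)
  have hmeas : Measurable fun q : (ℝ≥0∞ × ℝ) × ℝ => q.1.1 * φ (q.1.2 + q.2) := by fun_prop
  have h1 : ∫⁻ ω, H ω * φ (τ n ω) ∂P =
      ∫⁻ q, q.1.1 * φ (q.1.2 + q.2) ∂(P.map fun ω => ((H ω, prevPoint τ n ω), gap τ n ω)) := by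
    rw [lintegral_map hmeas (hV'.prodMk (hτ.measurable_gap n))]
    simp only [prevPoint_add_gap]
  rw [h1, hmap, hτ.map_gap, lintegral_prod _ hmeas.aemeasurable,
    lintegral_map hmeas.lintegral_prod_right' hV']
  refine lintegral_congr fun ω => ?_
  rw [lintegral_const_mul _ (by fun_prop)]
  rfl

end IsPoissonProcess

end gaps

/-! ### Void probabilities and the Campbell–Mecke formula -/

lemma expStep_exp_neg (s : ℝ) :
    expStep (fun u => ENNReal.ofReal (Real.exp (-u))) s =
      2⁻¹ * ENNReal.ofReal (Real.exp (-s)) := by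
  have h1 : ∫⁻ t in Set.Ioi (0 : ℝ), ENNReal.ofReal (Real.exp (-2 * t)) = 2⁻¹ := by
    rw [← ofReal_integral_eq_lintegral_ofReal (exp_neg_integrableOn_Ioi 0 two_pos)
      (ae_of_all _ fun _ => (Real.exp_pos _).le), integral_exp_mul_Ioi (by norm_num)]
    rw [← ENNReal.ofReal_ofNat, ← ENNReal.ofReal_inv_of_pos two_pos]
    norm_num
  rw [expStep, lintegral_expMeasure_one (fun t => ENNReal.ofReal (Real.exp (-(s + t))))
    (by fun_prop), ← h1, mul_comm, ← lintegral_const_mul _ (by fun_prop)]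
  refine lintegral_congr fun t => ?_
  rw [← ENNReal.ofReal_mul (Real.exp_pos _).le, ← ENNReal.ofReal_mul (Real.exp_pos _).le,
    ← Real.exp_add, ← Real.exp_add]
  ring_nf

lemma expMeasure_one_Iic_zero : expMeasure 1 (Set.Iic 0) = 0 := by
  rw [← lintegral_indicator_one measurableSet_Iic,
    lintegral_expMeasure_one _ (measurable_one.indicator measurableSet_Iic)]
  rw [setLIntegral_congr_fun (g := fun _ => 0) measurableSet_Ioi, lintegral_zero]
  intro t ht
  have : t ∉ Set.Iic (0 : ℝ) := by simpa using ht
  simp [this]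

lemma tendsto_setLIntegral_Ioi_atTop {f : ℝ → ℝ≥0∞} (hf : Measurable f) (hfin : ∫⁻ u, f u ≠ ∞) :
    Tendsto (fun s => ∫⁻ u in Set.Ioi s, f u) atTop (𝓝 0) := by
  simp_rw [← lintegral_indicator measurableSet_Ioi]
  rw [← lintegral_zero (μ := (volume : Measure ℝ))]
  refine tendsto_lintegral_filter_of_dominated_convergence f
    (Eventually.of_forall fun s => hf.indicator measurableSet_Ioi)
    (Eventually.of_forall fun s => ae_of_all _ fun u => Set.indicator_le_self _ _ _) hfin
    (ae_of_all _ fun u => ?_)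
  refine tendsto_const_nhds.congr' ?_
  filter_upwards [eventually_ge_atTop u] with s hs
  simp [hs]

/-- If `Φ` is invariant for the walk killed with survival probability `g`, then so is `F * Φ`, up
to the source term `f * Φ`, where `F` is the tail integral of `f`. -/
lemma expStep_tail_mul {f g Φ : ℝ → ℝ≥0∞} (hf : Measurable f) (hg : Measurable g)
    (hΦ : Measurable Φ) (hstep : ∀ s, expStep (fun u => g u * Φ u) s = Φ s) (s : ℝ) :
    expStep (fun u => f u * Φ u + g u * ((∫⁻ t in Set.Ioi u, f t) * Φ u)) s =
      (∫⁻ t in Set.Ioi s, f t) * Φ s := by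
  have hT : MeasurableSet {q : ℝ × ℝ | q.1 < q.2} := measurableSet_lt measurable_fst measurable_snd
  have hF : (fun u => ∫⁻ t in Set.Ioi u, f t) =
      fun u => ∫⁻ t, {q : ℝ × ℝ | q.1 < q.2}.indicator (fun q => f q.2) (u, t) := by
    funext u
    rw [← lintegral_indicator measurableSet_Ioi]
    rfl
  have hFm : Measurable fun u => ∫⁻ t in Set.Ioi u, f t := by
    rw [hF]
    exact Measurable.lintegral_prod_right' ((hf.comp measurable_snd).indicator hT)
  have hgΦ : Measurable fun u => g u * Φ u := hg.mul hΦ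
  have hw : Measurable fun u => ENNReal.ofReal (Real.exp (s - u)) * (g u * Φ u) := by fun_prop
  rw [expStep_eq _ (by fun_prop)]
  -- the part of the walk's invariance identity for `Φ` that lies beyond `t`
  have key : ∀ t ∈ Set.Ioi s, ENNReal.ofReal (Real.exp (s - t)) * Φ t +
      ∫⁻ u in Set.Ioo s t, ENNReal.ofReal (Real.exp (s - u)) * (g u * Φ u) = Φ s := by
    intro t ht
    have h1 : ENNReal.ofReal (Real.exp (s - t)) * Φ t =
        ∫⁻ u in Set.Ioi t, ENNReal.ofReal (Real.exp (s - u)) * (g u * Φ u) := by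
      conv_lhs => rw [← hstep t, expStep_eq _ hgΦ, ← lintegral_const_mul _ (by fun_prop)]
      refine lintegral_congr fun u => ?_
      rw [← mul_assoc, ← ENNReal.ofReal_mul (Real.exp_pos _).le, ← Real.exp_add]
      ring_nf
    rw [h1, ← hstep s, expStep_eq _ hgΦ, ← Set.Ioc_union_Ioi_eq_Ioi (Set.mem_Ioi.1 ht).le,
      lintegral_union measurableSet_Ioi (Set.Ioc_disjoint_Ioi le_rfl), add_comm]
    congr 1
    exact setLIntegral_congr Ioo_ae_eq_Ioc
  have hswap : ∫⁻ u in Set.Ioi s, ENNReal.ofReal (Real.exp (s - u)) *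
        (g u * ((∫⁻ t in Set.Ioi u, f t) * Φ u)) =
      ∫⁻ t in Set.Ioi s, f t *
        ∫⁻ u in Set.Ioo s t, ENNReal.ofReal (Real.exp (s - u)) * (g u * Φ u) := by
    have hk : Measurable fun q : ℝ × ℝ => {q : ℝ × ℝ | q.1 < q.2}.indicator
        (fun q => ENNReal.ofReal (Real.exp (s - q.1)) * (g q.1 * Φ q.1) * f q.2) q := by
      refine Measurable.indicator ?_ hT
      fun_prop
    calc _ = ∫⁻ u in Set.Ioi s, ∫⁻ t in Set.Ioi s, {q : ℝ × ℝ | q.1 < q.2}.indicator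
          (fun q => ENNReal.ofReal (Real.exp (s - q.1)) * (g q.1 * Φ q.1) * f q.2) (u, t) := by
          refine setLIntegral_congr_fun measurableSet_Ioi fun u hu => ?_
          have : ∫⁻ t in Set.Ioi u, f t = ∫⁻ t in Set.Ioi s, (Set.Ioi u).indicator f t := by
            rw [lintegral_indicator measurableSet_Ioi, Measure.restrict_restrict measurableSet_Ioi,
              Set.inter_eq_left.2 (Set.Ioi_subset_Ioi (Set.mem_Ioi.1 hu).le)]
          simp only [this]
          rw [show ENNReal.ofReal (Real.exp (s - u)) *
              (g u * ((∫⁻ t in Set.Ioi s, (Set.Ioi u).indicator f t) * Φ u)) =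
              (ENNReal.ofReal (Real.exp (s - u)) * (g u * Φ u)) *
              (∫⁻ t in Set.Ioi s, (Set.Ioi u).indicator f t) by ring,
            ← lintegral_const_mul _ (hf.indicator measurableSet_Ioi)]
          refine lintegral_congr fun t => ?_
          by_cases h : u < t <;> simp [h]
      _ = ∫⁻ t in Set.Ioi s, ∫⁻ u in Set.Ioi s, {q : ℝ × ℝ | q.1 < q.2}.indicator
          (fun q => ENNReal.ofReal (Real.exp (s - q.1)) * (g q.1 * Φ q.1) * f q.2) (u, t) :=
          lintegral_lintegral_swap hk.aemeasurable
      _ = _ := by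
          refine setLIntegral_congr_fun measurableSet_Ioi fun t ht => ?_
          have : ∫⁻ u in Set.Ioo s t, ENNReal.ofReal (Real.exp (s - u)) * (g u * Φ u) =
              ∫⁻ u in Set.Ioi s, (Set.Iio t).indicator
                (fun u => ENNReal.ofReal (Real.exp (s - u)) * (g u * Φ u)) u := by
            rw [lintegral_indicator measurableSet_Iio, Measure.restrict_restrict measurableSet_Iio,
              Set.inter_comm, Set.Ioi_inter_Iio]
          simp only [this]
          rw [← lintegral_const_mul _ (hw.indicator measurableSet_Iio)]
          refine lintegral_congr fun u => ?_
          by_cases h : u < t <;> simp [h, mul_comm]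
  simp only [mul_add]
  rw [lintegral_add_left (by fun_prop), hswap, ← lintegral_add_left (by fun_prop),
    ← lintegral_mul_const _ hf]
  refine setLIntegral_congr_fun measurableSet_Ioi fun t ht => ?_
  rw [← key t ht]
  ring

namespace IsPoissonProcess

variable {Ω : Type*} [MeasurableSpace Ω] {P : Measure Ω} [IsProbabilityMeasure P]
  {τ : ℕ → Ω → ℝ} (hτ : IsPoissonProcess P τ)
include hτ

omit [IsProbabilityMeasure P] in
lemma ae_gap_pos : ∀ᵐ ω ∂P, ∀ n, 0 < gap τ n ω := by
  refine ae_all_iff.2 fun n => ?_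
  have h : P (gap τ n ⁻¹' Set.Iic 0) = 0 := by
    rw [← Measure.map_apply (hτ.measurable_gap n) measurableSet_Iic, hτ.map_gap,
      expMeasure_one_Iic_zero]
  filter_upwards [measure_eq_zero_iff_ae_notMem.1 h] with ω hω
  simpa using hω

omit [IsProbabilityMeasure P] in
lemma ae_point_pos : ∀ᵐ ω ∂P, ∀ n, 0 < τ n ω := by
  filter_upwards [hτ.ae_gap_pos] with ω hω n
  induction n with
  | zero => exact hω 0
  | succ n ih =>
    rw [← prevPoint_add_gap τ (n + 1) ω]
    exact add_pos ih (hω (n + 1))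

lemma lintegral_exp_neg_point (n : ℕ) :
    ∫⁻ ω, ENNReal.ofReal (Real.exp (-τ n ω)) ∂P = 2⁻¹ ^ (n + 1) := by
  have step : ∀ n, ∫⁻ ω, ENNReal.ofReal (Real.exp (-τ n ω)) ∂P =
      2⁻¹ * ∫⁻ ω, ENNReal.ofReal (Real.exp (-prevPoint τ n ω)) ∂P := fun n => by
    have := hτ.lintegral_mul_point (n := n) (H := fun _ => 1) measurable_const
      (φ := fun u => ENNReal.ofReal (Real.exp (-u))) (by fun_prop)
    simp only [one_mul, expStep_exp_neg] at this
    rw [this, lintegral_const_mul]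
    have := hτ.measurable_prevPoint n
    fun_prop
  induction n with
  | zero => rw [step]; simp [prevPoint]
  | succ n ih => rw [step, pow_succ', ← ih]; rfl

/-- The points of a Poisson process tend to infinity. -/
lemma ae_tendsto_point : ∀ᵐ ω ∂P, Tendsto (fun n => τ n ω) atTop atTop := by
  have hm : ∀ n, Measurable fun ω => ENNReal.ofReal (Real.exp (-τ n ω)) := fun n => by
    have := hτ.measurable n
    fun_prop
  have hsum : ∫⁻ ω, ∑' n, ENNReal.ofReal (Real.exp (-τ n ω)) ∂P ≠ ∞ := by
    rw [lintegral_tsum fun n => (hm n).aemeasurable]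
    simp_rw [hτ.lintegral_exp_neg_point, pow_succ, ENNReal.tsum_mul_right, ENNReal.tsum_geometric]
    simp
  filter_upwards [ae_lt_top (Measurable.tsum hm) hsum] with ω hω
  have h := ENNReal.tendsto_atTop_zero_of_tsum_ne_top hω.ne
  have h2 := (ENNReal.tendsto_toReal ENNReal.zero_ne_top).comp h
  simp only [Function.comp_def, ENNReal.toReal_ofReal (Real.exp_pos _).le,
    ENNReal.toReal_zero] at h2
  have h3 := Real.tendsto_exp_comp_nhds_zero.1 h2
  simpa [Function.comp_def] using tendsto_neg_atBot_atTop.comp h3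

lemma ae_tendsto_prevPoint : ∀ᵐ ω ∂P, Tendsto (fun n => prevPoint τ n ω) atTop atTop := by
  filter_upwards [hτ.ae_tendsto_point] with ω hω
  exact (tendsto_add_atTop_iff_nat 1).1 hω

/-- The product functional of the points from the `m`-th on, given the first `m` points. -/
lemma tendsto_lintegral_prod_Ico {g Φ : ℝ → ℝ≥0∞} (hg : Measurable g) (hΦ : Measurable Φ)
    (hg1 : ∀ u, g u ≤ 1) (hΦ1 : ∀ u, Φ u ≤ 1)
    (hstep : ∀ s, expStep (fun u => g u * Φ u) s = Φ s) (hlim : Tendsto Φ atTop (𝓝 1))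
    {m : ℕ} {H : Ω → ℝ≥0∞} (hH : Measurable[past τ m] H) (hH1 : ∀ ω, H ω ≤ 1) :
    Tendsto (fun n => ∫⁻ ω, H ω * ∏ j ∈ Finset.Ico m n, g (τ j ω) ∂P) atTop
      (𝓝 (∫⁻ ω, H ω * Φ (prevPoint τ m ω) ∂P)) := by
  have hprod : ∀ n, m ≤ n →
      Measurable[past τ n] fun ω => H ω * ∏ j ∈ Finset.Ico m n, g (τ j ω) := fun n hn =>
    (hH.mono (past_mono τ hn) le_rfl).mul (Finset.measurable_fun_prod _ fun j hj =>
      hg.comp (measurable_past_point τ (Finset.mem_Ico.1 hj).2))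
  have hHm : Measurable H := hH.mono (hτ.past_le m) le_rfl
  have hpm : ∀ n, Measurable fun ω => H ω * ∏ j ∈ Finset.Ico m n, g (τ j ω) := fun n =>
    hHm.mul (Finset.measurable_fun_prod _ fun j hj => hg.comp (hτ.measurable j))
  -- multiplied by `Φ` at the last point, the partial products form a martingale
  have hmart : ∀ n, m ≤ n → ∫⁻ ω, (H ω * ∏ j ∈ Finset.Ico m n, g (τ j ω)) *
      Φ (prevPoint τ n ω) ∂P = ∫⁻ ω, H ω * Φ (prevPoint τ m ω) ∂P := by
    intro n hn
    induction n, hn using Nat.le_induction with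
    | base => simp
    | succ n hn ih =>
      rw [← ih]
      have := hτ.lintegral_mul_point (hprod n hn) (φ := fun u => g u * Φ u) (hg.mul hΦ)
      simp only [hstep] at this
      rw [← this]
      refine lintegral_congr fun ω => ?_
      rw [Finset.prod_Ico_succ_top hn, show prevPoint τ (n + 1) ω = τ n ω from rfl]
      ring
  have hle1 : ∀ n ω, H ω * ∏ j ∈ Finset.Ico m n, g (τ j ω) ≤ 1 := fun n ω =>
    mul_le_one' (hH1 ω) (Finset.prod_le_one' fun j _ => hg1 _)
  have hanti : ∀ ω, Antitone fun n => H ω * ∏ j ∈ Finset.Ico m n, g (τ j ω) := fun ω a b hab =>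
    mul_le_mul_right (Finset.prod_le_prod_of_subset_of_le_one'
      (Finset.Ico_subset_Ico_right hab) fun j _ _ => hg1 _) _
  have hlimit := fun ω => tendsto_atTop_iInf (hanti ω)
  have hL := tendsto_lintegral_of_dominated_convergence (μ := P) (fun _ => 1) hpm
    (fun n => ae_of_all _ (hle1 n)) (by simp) (ae_of_all _ hlimit)
  have hR := tendsto_lintegral_of_dominated_convergence (μ := P) (fun _ => 1)
    (F := fun n ω => (H ω * ∏ j ∈ Finset.Ico m n, g (τ j ω)) * Φ (prevPoint τ n ω))
    (fun n => (hpm n).mul (hΦ.comp (hτ.measurable_prevPoint n)))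
    (fun n => ae_of_all _ fun ω => mul_le_one' (hle1 n ω) (hΦ1 _)) (by simp) (by
      filter_upwards [hτ.ae_tendsto_prevPoint] with ω hω
      exact ENNReal.Tendsto.mul (hlimit ω) (Or.inr ENNReal.one_ne_top) (hlim.comp hω)
        (Or.inl one_ne_zero))
  simp only [mul_one] at hR
  have hconst := tendsto_nhds_unique hR (tendsto_const_nhds.congr'
    ((eventually_ge_atTop m).mono fun n hn => (hmart n hn).symm))
  rwa [← hconst]

/-- A form of the Campbell–Mecke formula: each point is weighted by `f`, all points before it
by `g`, and all points after it by `g` in the mean, through `Φ`. -/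
lemma tsum_lintegral_prod_range {f g Φ : ℝ → ℝ≥0∞} (hf : Measurable f) (hg : Measurable g)
    (hΦ : Measurable Φ) (hfin : ∫⁻ u, f u ≠ ∞) (hg1 : ∀ u, g u ≤ 1) (hΦ1 : ∀ u, Φ u ≤ 1)
    (hstep : ∀ s, expStep (fun u => g u * Φ u) s = Φ s) :
    ∑' i, ∫⁻ ω, (∏ j ∈ Finset.range i, g (τ j ω)) * (f (τ i ω) * Φ (τ i ω)) ∂P =
      (∫⁻ u in Set.Ioi 0, f u) * Φ 0 := by
  set F : ℝ → ℝ≥0∞ := fun s => ∫⁻ u in Set.Ioi s, f u with hFdef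
  have hFanti : Antitone F := fun a b hab =>
    lintegral_mono_set (Set.Ioi_subset_Ioi hab)
  have hFm : Measurable F := hFanti.measurable
  have hprod : ∀ n, Measurable[past τ n] fun ω => ∏ j ∈ Finset.range n, g (τ j ω) := fun n =>
    Finset.measurable_fun_prod _ fun j hj =>
      hg.comp (measurable_past_point τ (Finset.mem_range.1 hj))
  have hpm : ∀ n, Measurable fun ω => ∏ j ∈ Finset.range n, g (τ j ω) := fun n =>
    (hprod n).mono (hτ.past_le n) le_rfl
  have hsum : ∀ n, ∑ i ∈ Finset.range n,
        ∫⁻ ω, (∏ j ∈ Finset.range i, g (τ j ω)) * (f (τ i ω) * Φ (τ i ω)) ∂P +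
      ∫⁻ ω, (∏ j ∈ Finset.range n, g (τ j ω)) * (F (prevPoint τ n ω) * Φ (prevPoint τ n ω)) ∂P =
      F 0 * Φ 0 := by
    intro n
    induction n with
    | zero => simp [prevPoint]
    | succ n ih =>
      rw [← ih, Finset.sum_range_succ, add_assoc]
      congr 1
      have := hτ.lintegral_mul_point (hprod n)
        (φ := fun u => f u * Φ u + g u * (F u * Φ u)) (by fun_prop)
      simp only [hFdef, expStep_tail_mul hf hg hΦ hstep] at this
      rw [← this, ← lintegral_add_left]
      · refine lintegral_congr fun ω => ?_
        rw [Finset.prod_range_succ, show prevPoint τ (n + 1) ω = τ n ω from rfl]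
        ring
      · have := hpm n
        have := hτ.measurable n
        fun_prop
  have hrem : Tendsto (fun n => ∫⁻ ω, (∏ j ∈ Finset.range n, g (τ j ω)) *
      (F (prevPoint τ n ω) * Φ (prevPoint τ n ω)) ∂P) atTop (𝓝 0) := by
    rw [← lintegral_zero (μ := P)]
    refine tendsto_lintegral_of_dominated_convergence (fun _ => ∫⁻ u, f u) (fun n => ?_)
      (fun n => ae_of_all _ fun ω => ?_) (by simpa using hfin) ?_
    · have := hpm n
      have := hτ.measurable_prevPoint n
      fun_prop
    · calc _ ≤ 1 * (F (prevPoint τ n ω) * 1) := 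
            mul_le_mul' (Finset.prod_le_one' fun j _ => hg1 _)
              (mul_le_mul' le_rfl (hΦ1 _))
        _ ≤ _ := by simpa using setLIntegral_le_lintegral _ _
    · filter_upwards [hτ.ae_tendsto_prevPoint] with ω hω
      refine tendsto_of_tendsto_of_tendsto_of_le_of_le tendsto_const_nhds
        ((tendsto_setLIntegral_Ioi_atTop hf hfin).comp hω) (fun _ => zero_le) fun n => ?_
      calc _ ≤ 1 * (F (prevPoint τ n ω) * 1) := 
            mul_le_mul' (Finset.prod_le_one' fun j _ => hg1 _)
              (mul_le_mul' le_rfl (hΦ1 _))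
        _ = _ := by simp [hFdef]
  have h := (ENNReal.tendsto_nat_tsum fun i =>
    ∫⁻ ω, (∏ j ∈ Finset.range i, g (τ j ω)) * (f (τ i ω) * Φ (τ i ω)) ∂P).add hrem
  simp only [hsum, add_zero] at h
  exact tendsto_nhds_unique h tendsto_const_nhds

end IsPoissonProcess

/-! ### The laws of the messages -/

/-- The law with an atom of mass `1 - c` at `0` and density `c * exp (-t)` on `(0, ∞)`. The
messages started from `0` have a law of this form after every number of iterations. -/
noncomputable def messageLaw (c : ℝ) : Measure ℝ :=
  ENNReal.ofReal (1 - c) • Measure.dirac 0 + ENNReal.ofReal c • expMeasure 1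

lemma expMeasure_one_Ioi {y : ℝ} (hy : 0 ≤ y) :
    expMeasure 1 (Set.Ioi y) = ENNReal.ofReal (Real.exp (-y)) := by
  rw [← lintegral_indicator_one measurableSet_Ioi,
    lintegral_expMeasure_one _ (measurable_one.indicator measurableSet_Ioi)]
  have h : ∀ t, ENNReal.ofReal (Real.exp (-t)) * (Set.Ioi y).indicator 1 t =
      (Set.Ioi y).indicator (fun t => ENNReal.ofReal (Real.exp (-t))) t := fun t => by
    by_cases ht : y < t <;> simp [ht]
  simp_rw [h]
  rw [lintegral_indicator measurableSet_Ioi, Measure.restrict_restrict measurableSet_Ioi,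
    Set.inter_eq_left.2 (Set.Ioi_subset_Ioi hy), ← ofReal_integral_eq_lintegral_ofReal
      (integrableOn_exp_neg_Ioi y) (ae_of_all _ fun _ => (Real.exp_pos _).le),
    integral_exp_neg_Ioi]

instance : NullSingletonClass (expMeasure 1) := by
  have h1 : expMeasure 1 = volume.withDensity (exponentialPDF 1) := rfl
  exact ⟨fun x => h1 ▸ withDensity_absolutelyContinuous _ _ (measure_singleton x)⟩

lemma expMeasure_one_Iio_of_nonpos {t : ℝ} (ht : t ≤ 0) : expMeasure 1 (Set.Iio t) = 0 :=
  measure_mono_null (fun _ h => (lt_of_lt_of_le h ht).le) expMeasure_one_Iic_zero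

lemma expMeasure_one_Iio {t : ℝ} (ht : 0 ≤ t) :
    expMeasure 1 (Set.Iio t) = ENNReal.ofReal (1 - Real.exp (-t)) := by
  rw [← Set.compl_Ici, prob_compl_eq_one_sub measurableSet_Ici, ← measure_congr Ioi_ae_eq_Ici,
    expMeasure_one_Ioi ht, ENNReal.ofReal_sub _ (Real.exp_pos _).le, ENNReal.ofReal_one]

section messageLaw

variable {c : ℝ} (h0 : 0 ≤ c) (h1 : c ≤ 1)
include h0 h1

lemma isProbabilityMeasure_messageLaw : IsProbabilityMeasure (messageLaw c) := by
  constructor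
  simp [messageLaw, ← ENNReal.ofReal_add (sub_nonneg.2 h1) h0]

lemma messageLaw_Ioi (y : ℝ) :
    messageLaw c (Set.Ioi y) = if 0 ≤ y then ENNReal.ofReal (c * Real.exp (-y)) else 1 := by
  split_ifs with hy
  · simp [messageLaw, expMeasure_one_Ioi hy, hy, ENNReal.ofReal_mul h0]
  · have := isProbabilityMeasure_messageLaw h0 h1
    rw [prob_compl_eq_zero_iff measurableSet_Ioi |>.symm, Set.compl_Ioi]
    have : expMeasure 1 (Set.Iic y) = 0 :=
      measure_mono_null (Set.Iic_subset_Iic.2 (not_le.1 hy).le) expMeasure_one_Iic_zero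
    simp [messageLaw, this, not_le.1 hy]

lemma messageLaw_Iio (t : ℝ) : messageLaw c (Set.Iio t) =
    if t ≤ 0 then 0 else ENNReal.ofReal (1 - c * Real.exp (-t)) := by
  split_ifs with ht
  · simp [messageLaw, expMeasure_one_Iio_of_nonpos ht, ht]
  · push Not at ht
    have : 0 ≤ 1 - Real.exp (-t) := by simpa using ht.le
    simp only [messageLaw, Measure.add_apply, Measure.smul_apply, smul_eq_mul,
      expMeasure_one_Iio ht.le, Measure.dirac_apply, Set.indicator_of_mem (Set.mem_Iio.2 ht),
      Pi.one_apply, mul_one]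
    rw [← ENNReal.ofReal_mul h0, ← ENNReal.ofReal_add (sub_nonneg.2 h1) (by positivity)]
    ring_nf

lemma messageLaw_Ici_le (t : ℝ) :
    messageLaw c (Set.Ici t) ≤ ENNReal.ofReal (Real.exp (-t)) := by
  have := isProbabilityMeasure_messageLaw h0 h1
  rw [← Set.compl_Iio, prob_compl_eq_one_sub measurableSet_Iio, messageLaw_Iio h0 h1]
  split_ifs with ht
  · simpa using ht
  · rw [tsub_le_iff_right, ← ENNReal.ofReal_one]
    refine (ENNReal.ofReal_le_ofReal ?_).trans ENNReal.ofReal_add_le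
    nlinarith [Real.exp_pos (-t)]

lemma map_eq_messageLaw {Ω : Type*} [MeasurableSpace Ω] {P : Measure Ω} [IsProbabilityMeasure P]
    {A : Ω → ℝ} (hA : Measurable A)
    (h : ∀ y, P {ω | y < A ω} = if 0 ≤ y then ENNReal.ofReal (c * Real.exp (-y)) else 1) :
    P.map A = messageLaw c := by
  have := isProbabilityMeasure_messageLaw h0 h1
  have := Measure.isProbabilityMeasure_map (μ := P) hA.aemeasurable
  refine Measure.ext_of_Iic _ _ fun y => ?_
  rw [← Set.compl_Ioi, prob_compl_eq_one_sub measurableSet_Ioi,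
    prob_compl_eq_one_sub measurableSet_Ioi, messageLaw_Ioi h0 h1, Measure.map_apply hA
    measurableSet_Ioi, ← h]
  rfl

end messageLaw

/-! ### The void probabilities of a marked Poisson process -/

/-- The probability that a point at `z` with a mark `a` of law `messageLaw c` satisfies
`y < (z - a)⁺`. -/
noncomputable def survival (c y z : ℝ) : ℝ≥0∞ := messageLaw c {a | y < max (z - a) 0}

/-- The probability that `y < (z - a)⁺` for all points `z > s` with marks `a`, in a Poisson process
with independent marks of law `messageLaw c`. -/
noncomputable def voidProb (c y s : ℝ) : ℝ≥0∞ :=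
  if 0 ≤ y then ENNReal.ofReal (Real.exp (min (s - y) 0 - c * Real.exp (-max (s - y) 0))) else 1

section void

variable {c : ℝ} (h0 : 0 ≤ c) (h1 : c ≤ 1) (y : ℝ)

lemma measurable_voidProb : Measurable (voidProb c y) := by
  unfold voidProb
  split_ifs <;> fun_prop

lemma voidProb_zero :
    voidProb c y 0 = if 0 ≤ y then ENNReal.ofReal (Real.exp (-c) * Real.exp (-y)) else 1 := by
  unfold voidProb
  split_ifs with hy
  · rw [min_eq_left (by linarith), max_eq_right (by linarith), ← Real.exp_add]
    simp [sub_eq_neg_add]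
  · rfl

lemma tendsto_voidProb : Tendsto (voidProb c y) atTop (𝓝 1) := by
  unfold voidProb
  split_ifs
  · have h : Tendsto (fun s : ℝ => ENNReal.ofReal (Real.exp (0 - c * Real.exp (-(s - y))))) atTop
        (𝓝 (ENNReal.ofReal (Real.exp (0 - c * 0)))) := by
      refine ENNReal.tendsto_ofReal ((Real.continuous_exp.tendsto _).comp
        (tendsto_const_nhds.sub (Tendsto.const_mul _ ?_)))
      exact Real.tendsto_exp_neg_atTop_nhds_zero.comp (tendsto_atTop_add_const_right _ _ tendsto_id)
    simp only [mul_zero, sub_zero, Real.exp_zero, ENNReal.ofReal_one] at h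
    refine h.congr' ?_
    filter_upwards [eventually_ge_atTop y] with s hs
    rw [min_eq_right (by linarith), max_eq_left (by linarith)]
  · exact tendsto_const_nhds

include h0

lemma voidProb_le_one (s : ℝ) : voidProb c y s ≤ 1 := by
  unfold voidProb
  split_ifs
  · rw [← ENNReal.ofReal_one]
    refine ENNReal.ofReal_le_ofReal (Real.exp_le_one_iff.2 ?_)
    have := min_le_right (s - y) 0
    have := mul_nonneg h0 (Real.exp_pos (-max (s - y) 0)).le
    linarith
  · rfl

include h1

lemma survival_eq (z : ℝ) : survival c y z = if 0 ≤ y then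
    if z ≤ y then 0 else ENNReal.ofReal (1 - c * Real.exp (-(z - y))) else 1 := by
  unfold survival
  split_ifs with hy hz
  · have : {a | y < max (z - a) 0} = Set.Iio (z - y) := by
      ext a; simp [not_lt.2 hy, lt_sub_comm]
    rw [this, messageLaw_Iio h0 h1, if_pos (by linarith)]
  · have : {a | y < max (z - a) 0} = Set.Iio (z - y) := by
      ext a; simp [not_lt.2 hy, lt_sub_comm]
    rw [this, messageLaw_Iio h0 h1, if_neg (by linarith)]
  · have := isProbabilityMeasure_messageLaw h0 h1
    have : {a | y < max (z - a) 0} = Set.univ := by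
      ext a; simp [not_le.1 hy]
    rw [this, measure_univ]

lemma measurable_survival : Measurable (survival c y) := by
  have : survival c y = fun z => if 0 ≤ y then
    if z ≤ y then 0 else ENNReal.ofReal (1 - c * Real.exp (-(z - y))) else 1 :=
    funext (survival_eq h0 h1 y)
  rw [this]
  split_ifs
  · exact Measurable.ite measurableSet_Iic measurable_const (by fun_prop)
  · exact measurable_const

lemma survival_le_one (z : ℝ) : survival c y z ≤ 1 := by
  have := isProbabilityMeasure_messageLaw h0 h1
  exact prob_le_one

lemma expStep_voidProb (s : ℝ) :
    expStep (fun u => survival c y u * voidProb c y u) s = voidProb c y s := by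
  by_cases hy : 0 ≤ y
  swap
  · simp [survival_eq h0 h1, voidProb, hy, expStep]
  have hm : Measurable fun u => survival c y u * voidProb c y u :=
    (measurable_survival h0 h1 y).mul (measurable_voidProb y)
  -- an explicit primitive beyond `y`
  have far : ∀ s, y ≤ s → expStep (fun u => survival c y u * voidProb c y u) s =
      ENNReal.ofReal (Real.exp (-(c * Real.exp (-(s - y))))) := by
    intro s hs
    rw [expStep_eq _ hm]
    set G : ℝ → ℝ := fun u => -(Real.exp (s - u) * Real.exp (-(c * Real.exp (-(u - y))))) with hG
    set G' : ℝ → ℝ := fun u => Real.exp (s - u) * ((1 - c * Real.exp (-(u - y))) *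
      Real.exp (-(c * Real.exp (-(u - y))))) with hG'
    have hderiv : ∀ u ∈ Set.Ici s, HasDerivAt G (G' u) u := by
      intro u _
      have e1 : HasDerivAt (fun u => Real.exp (s - u)) (Real.exp (s - u) * (0 - 1)) u :=
        ((hasDerivAt_const u s).sub (hasDerivAt_id u)).exp
      have e2 : HasDerivAt (fun u => Real.exp (-(u - y))) (Real.exp (-(u - y)) * (-1)) u :=
        ((hasDerivAt_id u).sub_const y).neg.exp
      refine (e1.mul (e2.const_mul c).neg.exp).neg.congr_deriv ?_
      simp only [hG', Pi.neg_apply]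
      ring
    have hpos : ∀ u ∈ Set.Ioi s, 0 ≤ G' u := by
      intro u hu
      have hu' : s < u := hu
      have : Real.exp (-(u - y)) ≤ 1 := Real.exp_le_one_iff.2 (by linarith)
      have : c * Real.exp (-(u - y)) ≤ 1 := mul_le_one₀ h1 (Real.exp_pos _).le this
      have : 0 ≤ 1 - c * Real.exp (-(u - y)) := by linarith
      positivity
    have hlim : Tendsto G atTop (𝓝 0) := by
      have a1 : Tendsto (fun u => Real.exp (s - u)) atTop (𝓝 0) :=
        Real.tendsto_exp_atBot.comp (tendsto_const_nhds.add_atBot tendsto_neg_atTop_atBot)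
      have a2 : Tendsto (fun u => Real.exp (-(c * Real.exp (-(u - y))))) atTop
          (𝓝 (Real.exp (-(c * 0)))) := by
        refine (Real.continuous_exp.tendsto _).comp (Tendsto.neg (Tendsto.const_mul _ ?_))
        exact Real.tendsto_exp_neg_atTop_nhds_zero.comp
          (tendsto_atTop_add_const_right _ _ tendsto_id)
      simpa [hG] using (a1.mul a2).neg
    have hint := integral_Ioi_of_hasDerivAt_of_nonneg' hderiv hpos hlim
    have hval : G s = -Real.exp (-(c * Real.exp (-(s - y)))) := by simp [hG]
    rw [hval, zero_sub, neg_neg] at hint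
    rw [← hint, ofReal_integral_eq_lintegral_ofReal
      (integrableOn_Ioi_deriv_of_nonneg' hderiv hpos hlim)
      ((ae_restrict_iff' measurableSet_Ioi).2 (ae_of_all _ hpos))]
    refine setLIntegral_congr_fun measurableSet_Ioi fun u hu => ?_
    have hu' : y < u := lt_of_le_of_lt hs hu
    have hp : 0 ≤ 1 - c * Real.exp (-(u - y)) := by
      have : Real.exp (-(u - y)) ≤ 1 := Real.exp_le_one_iff.2 (by linarith)
      have : c * Real.exp (-(u - y)) ≤ 1 := mul_le_one₀ h1 (Real.exp_pos _).le this
      linarith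
    simp only [survival_eq h0 h1, voidProb, if_pos hy, if_neg (not_le.2 hu'), hG']
    rw [min_eq_right (by linarith), max_eq_left (by linarith), zero_sub,
      ENNReal.ofReal_mul (Real.exp_pos _).le, ENNReal.ofReal_mul hp]
  rcases le_total y s with hs | hs
  · rw [far s hs, voidProb, if_pos hy, min_eq_right (by linarith), max_eq_left (by linarith),
      zero_sub]
  · -- below `y` no point can survive, so the walk has to jump beyond `y`
    have : expStep (fun u => survival c y u * voidProb c y u) s =
        ENNReal.ofReal (Real.exp (s - y)) *
          expStep (fun u => survival c y u * voidProb c y u) y := by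
      rw [expStep_eq _ hm, expStep_eq _ hm, ← Set.Ioc_union_Ioi_eq_Ioi hs,
        lintegral_union measurableSet_Ioi (Set.Ioc_disjoint_Ioi le_rfl),
        setLIntegral_congr_fun (g := fun _ => 0) measurableSet_Ioc, lintegral_zero, zero_add,
        ← lintegral_const_mul _ (by fun_prop)]
      · refine lintegral_congr fun u => ?_
        rw [← mul_assoc (ENNReal.ofReal (Real.exp (s - y))),
          ← ENNReal.ofReal_mul (Real.exp_pos _).le, ← Real.exp_add]
        ring_nf
      · intro u hu
        simp [survival_eq h0 h1, hy, hu.2]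
    rw [this, far y le_rfl, voidProb, if_pos hy, min_eq_left (by linarith),
      max_eq_right (by linarith), ← ENNReal.ofReal_mul (Real.exp_pos _).le, ← Real.exp_add]
    simp [sub_eq_add_neg]

end void

section marking

variable {Ω : Type*} [MeasurableSpace Ω]

/-- `A i` are marks for the points `τ i`: i.i.d. with law `messageLaw c` and independent of the
points. -/
structure IsMarking (P : Measure Ω) (τ A : ℕ → Ω → ℝ) (c : ℝ) : Prop where
  measurable : ∀ i, Measurable (A i)
  map_eq : ∀ i, P.map (A i) = messageLaw c
  iIndepFun : iIndepFun A P
  indepFun : IndepFun (fun ω i => τ i ω) (fun ω i => A i ω) P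

/-- A variable without atoms almost surely differs from an independent one. -/
lemma measure_eq_zero_of_indepFun {P : Measure Ω} [IsProbabilityMeasure P] {U V : Ω → ℝ}
    (hU : Measurable U) (hV : Measurable V) (h : IndepFun U V P)
    (hat : ∀ x, P {ω | U ω = x} = 0) : P {ω | U ω = V ω} = 0 := by
  have hmap := (indepFun_iff_map_prod_eq_prod_map_map hU.aemeasurable hV.aemeasurable).1 h
  have hD : MeasurableSet {q : ℝ × ℝ | q.1 = q.2} :=
    measurableSet_eq_fun measurable_fst measurable_snd
  have h1 : P {ω | U ω = V ω} = P.map (fun ω => (U ω, V ω)) {q : ℝ × ℝ | q.1 = q.2} := by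
    rw [Measure.map_apply (hU.prodMk hV) hD]
    rfl
  rw [h1, hmap, Measure.prod_apply_symm hD]
  refine (lintegral_congr fun y => ?_).trans lintegral_zero
  rw [Measure.map_apply hU (hD.preimage (by fun_prop))]
  exact hat y

lemma lt_ciInf_iff_of_tendsto_cofinite {ι : Type*} [Nonempty ι] {a : ι → ℝ}
    (ha : Tendsto a cofinite atTop) {y : ℝ} : y < ⨅ i, a i ↔ ∀ i, y < a i := by
  obtain ⟨i₀, hi₀⟩ := ha.exists_forall_le
  have hbdd : BddBelow (Set.range a) := ⟨a i₀, by rintro _ ⟨i, rfl⟩; exact hi₀ i⟩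
  refine ⟨fun h i => h.trans_le (ciInf_le hbdd i), fun h => ?_⟩
  exact (h i₀).trans_le (le_ciInf hi₀)

namespace IsPoissonProcess

variable {P : Measure Ω} [IsProbabilityMeasure P] {τ : ℕ → Ω → ℝ} (hτ : IsPoissonProcess P τ)
include hτ

omit [IsProbabilityMeasure P] in
lemma measure_gap_eq (i : ℕ) (x : ℝ) : P {ω | gap τ i ω = x} = 0 := by
  have h : P {ω | gap τ i ω = x} = P.map (gap τ i) {x} := by
    rw [Measure.map_apply (hτ.measurable_gap i) (measurableSet_singleton x)]
    rfl
  rw [h, hτ.map_gap, measure_singleton]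

lemma measure_point_eq (i : ℕ) (x : ℝ) : P {ω | τ i ω = x} = 0 := by
  have hV : Measurable[past τ i] fun ω => x - prevPoint τ i ω :=
    (measurable_past_prevPoint τ i).const_sub x
  have := measure_eq_zero_of_indepFun (hτ.measurable_gap i) (hV.mono (hτ.past_le i) le_rfl)
    (hτ.indepFun_gap_of_past hV).symm (hτ.measure_gap_eq i)
  convert this using 4 with ω
  rw [← prevPoint_add_gap τ i ω]
  exact ⟨fun h => by linarith, fun h => by linarith⟩

lemma measure_point_sub_eq {i j : ℕ} (hij : i < j) (x : ℝ) :
    P {ω | τ j ω - τ i ω = x} = 0 := by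
  have hV : Measurable[past τ j] fun ω => x + τ i ω - prevPoint τ j ω :=
    ((measurable_past_point τ hij).const_add x).sub (measurable_past_prevPoint τ j)
  have := measure_eq_zero_of_indepFun (hτ.measurable_gap j) (hV.mono (hτ.past_le j) le_rfl)
    (hτ.indepFun_gap_of_past hV).symm (hτ.measure_gap_eq j)
  convert this using 4 with ω
  rw [← prevPoint_add_gap τ j ω]
  exact ⟨fun h => by linarith, fun h => by linarith⟩

variable {A : ℕ → Ω → ℝ} {c : ℝ} (hA : IsMarking P τ A c)
include hA

/-- Almost surely no slack `τ i - A i` vanishes, and no two of them agree. -/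
lemma ae_no_ties : ∀ᵐ ω ∂P, (∀ i, τ i ω - A i ω ≠ 0) ∧
    ∀ i j, i ≠ j → τ i ω - A i ω ≠ τ j ω - A j ω := by
  have h1 : ∀ i, ∀ᵐ ω ∂P, τ i ω - A i ω ≠ 0 := fun i => by
    have := measure_eq_zero_of_indepFun (hτ.measurable i) (hA.measurable i)
      (hA.indepFun.comp (measurable_pi_apply i) (measurable_pi_apply i)) (hτ.measure_point_eq i)
    filter_upwards [measure_eq_zero_iff_ae_notMem.1 this] with ω hω h
    exact hω (sub_eq_zero.1 h)
  have h2 : ∀ i j, i < j → ∀ᵐ ω ∂P, τ i ω - A i ω ≠ τ j ω - A j ω := fun i j hij => by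
    have := measure_eq_zero_of_indepFun ((hτ.measurable j).sub (hτ.measurable i))
      ((hA.measurable j).sub (hA.measurable i))
      (hA.indepFun.comp (φ := fun a : ℕ → ℝ => a j - a i) (ψ := fun a : ℕ → ℝ => a j - a i)
        (by fun_prop) (by fun_prop)) (hτ.measure_point_sub_eq hij)
    filter_upwards [measure_eq_zero_iff_ae_notMem.1 this] with ω hω h
    refine hω ?_
    change τ j ω - τ i ω = A j ω - A i ω
    linarith
  refine (ae_all_iff.2 h1).and (ae_all_iff.2 fun i => ae_all_iff.2 fun j => ?_)
  rcases lt_trichotomy i j with h | h | h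
  · exact (h2 i j h).mono fun _ h _ => h
  · exact ae_of_all _ fun _ h' => absurd h h'
  · exact (h2 j i h).mono fun _ h _ => h.symm

/-- Given the points, the marks contribute a product. -/
lemma measure_forall_mem (S : ℕ → Set (ℝ × ℝ)) (hS : ∀ j, MeasurableSet (S j)) (s : Finset ℕ) :
    P {ω | ∀ j ∈ s, (τ j ω, A j ω) ∈ S j} =
      ∫⁻ ω, ∏ j ∈ s, messageLaw c (Prod.mk (τ j ω) ⁻¹' S j) ∂P := by
  have hT : Measurable fun ω i => τ i ω := measurable_pi_lambda _ hτ.measurable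
  have hM : Measurable fun ω i => A i ω := measurable_pi_lambda _ hA.measurable
  have hmap := (indepFun_iff_map_prod_eq_prod_map_map hT.aemeasurable hM.aemeasurable).1
    hA.indepFun
  have hE : MeasurableSet {q : (ℕ → ℝ) × (ℕ → ℝ) | ∀ j ∈ s, (q.1 j, q.2 j) ∈ S j} := by
    have : {q : (ℕ → ℝ) × (ℕ → ℝ) | ∀ j ∈ s, (q.1 j, q.2 j) ∈ S j} =
        ⋂ j ∈ s, (fun q : (ℕ → ℝ) × (ℕ → ℝ) => (q.1 j, q.2 j)) ⁻¹' S j := by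
      ext; simp
    rw [this]
    exact Finset.measurableSet_biInter _ fun j _ => (hS j).preimage (by fun_prop)
  have h1 : P {ω | ∀ j ∈ s, (τ j ω, A j ω) ∈ S j} =
      P.map (fun ω => ((fun i => τ i ω), (fun i => A i ω)))
        {q : (ℕ → ℝ) × (ℕ → ℝ) | ∀ j ∈ s, (q.1 j, q.2 j) ∈ S j} := by
    rw [Measure.map_apply (hT.prodMk hM) hE]
    rfl
  rw [h1, hmap, Measure.prod_apply hE, lintegral_map (measurable_measure_prodMk_left hE) hT]
  refine lintegral_congr fun ω => ?_
  rw [Measure.map_apply hM (hE.preimage (by fun_prop))]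
  have h2 : (fun ω i => A i ω) ⁻¹' (Prod.mk (fun i => τ i ω) ⁻¹'
      {q : (ℕ → ℝ) × (ℕ → ℝ) | ∀ j ∈ s, (q.1 j, q.2 j) ∈ S j}) =
      ⋂ j ∈ s, A j ⁻¹' (Prod.mk (τ j ω) ⁻¹' S j) := by
    ext; simp
  rw [h2, hA.iIndepFun.measure_inter_preimage_eq_mul s
    fun j _ => (hS j).preimage (by fun_prop)]
  refine Finset.prod_congr rfl fun j _ => ?_
  rw [← hA.map_eq j, Measure.map_apply (hA.measurable j) ((hS j).preimage (by fun_prop))]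

variable (h0 : 0 ≤ c) (h1 : c ≤ 1)
include h0 h1

/-- The slacks `τ j - A j` tend to infinity, by the Borel–Cantelli lemma. -/
lemma ae_tendsto_sub : ∀ᵐ ω ∂P, Tendsto (fun j => τ j ω - A j ω) atTop atTop := by
  have hN : ∀ N : ℕ, ∀ᵐ ω ∂P, ∀ᶠ j in atTop, (N : ℝ) < τ j ω - A j ω := by
    intro N
    have hprob := isProbabilityMeasure_messageLaw h0 h1
    set S : Set (ℝ × ℝ) := {q | 0 < q.1 ∧ q.1 - q.2 ≤ N} with hS
    have hSm : MeasurableSet S := (measurableSet_lt measurable_const measurable_fst).inter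
      (measurableSet_le (measurable_fst.sub measurable_snd) measurable_const)
    set f : ℝ → ℝ≥0∞ := fun z => messageLaw c (Prod.mk z ⁻¹' S) with hf
    have hfm : Measurable f := measurable_measure_prodMk_left hSm
    have hfle : ∀ z, f z ≤
        (Set.Ioi 0).indicator (fun z : ℝ => ENNReal.ofReal (Real.exp (N - z))) z := by
      intro z
      by_cases hz : 0 < z
      · rw [Set.indicator_of_mem (Set.mem_Ioi.2 hz), ← neg_sub z (N : ℝ)]
        refine le_trans (measure_mono ?_) (messageLaw_Ici_le h0 h1 _)
        intro a ha
        have : z - a ≤ N := ha.2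
        simp only [Set.mem_Ici]
        linarith
      · have : Prod.mk z ⁻¹' S = ∅ := by
          ext a; simp [hS, hz]
        simp [hf, this]
    have hfin : ∫⁻ u, f u ≠ ∞ := by
      refine ne_top_of_le_ne_top ?_ (lintegral_mono hfle)
      rw [lintegral_indicator measurableSet_Ioi]
      simp_rw [sub_eq_add_neg, Real.exp_add, ENNReal.ofReal_mul (Real.exp_pos _).le]
      rw [lintegral_const_mul _ (by fun_prop)]
      refine ENNReal.mul_ne_top ENNReal.ofReal_ne_top ?_
      rw [← ofReal_integral_eq_lintegral_ofReal (integrableOn_exp_neg_Ioi 0)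
        (ae_of_all _ fun _ => (Real.exp_pos _).le)]
      exact ENNReal.ofReal_ne_top
    have hsum := hτ.tsum_lintegral_prod_range (g := fun _ => 1) (Φ := fun _ => 1) hfm
      measurable_const measurable_const hfin (fun _ => le_rfl) (fun _ => le_rfl)
      (by simp [expStep])
    have hP : ∀ i, P {ω | (τ i ω, A i ω) ∈ S} =
        ∫⁻ ω, (∏ j ∈ Finset.range i, 1) * (f (τ i ω) * 1) ∂P := fun i => by
      simpa using hτ.measure_forall_mem hA (fun _ => S) (fun _ => hSm) {i}
    have hne : ∑' i, P {ω | (τ i ω, A i ω) ∈ S} ≠ ∞ := by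
      simp_rw [hP]
      rw [hsum, mul_one]
      exact ne_top_of_le_ne_top hfin (setLIntegral_le_lintegral _ _)
    filter_upwards [ae_eventually_notMem hne, hτ.ae_point_pos] with ω hω hpos
    filter_upwards [hω] with j hj
    by_contra hcon
    exact hj ⟨hpos j, not_lt.1 hcon⟩
  filter_upwards [ae_all_iff.2 hN] with ω hω
  refine tendsto_atTop.2 fun b => ?_
  obtain ⟨N, hbN⟩ := exists_nat_ge b
  exact (hω N).mono fun j hj => hbN.trans hj.le

lemma ae_tendsto_max : ∀ᵐ ω ∂P, Tendsto (fun j => max (τ j ω - A j ω) 0) cofinite atTop := by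
  filter_upwards [hτ.ae_tendsto_sub hA h0 h1] with ω hω
  rw [Nat.cofinite_eq_atTop]
  exact tendsto_atTop_mono (fun _ => le_max_left _ _) hω

/-- The tail of the minimum of the slacks. -/
lemma measure_lt_iInf (y : ℝ) :
    P {ω | y < ⨅ j, max (τ j ω - A j ω) 0} =
      if 0 ≤ y then ENNReal.ofReal (Real.exp (-c) * Real.exp (-y)) else 1 := by
  set S : Set (ℝ × ℝ) := {q | y < max (q.1 - q.2) 0} with hS
  have hSm : MeasurableSet S := measurableSet_lt measurable_const (by fun_prop)
  set E : ℕ → Set Ω := fun n => {ω | ∀ j ∈ Finset.range n, (τ j ω, A j ω) ∈ S} with hE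
  have hEm : ∀ n, MeasurableSet (E n) := fun n => by
    have : E n = ⋂ j ∈ Finset.range n, (fun ω => (τ j ω, A j ω)) ⁻¹' S := by ext; simp [hE]
    rw [this]
    exact Finset.measurableSet_biInter _ fun j _ =>
      hSm.preimage ((hτ.measurable j).prodMk (hA.measurable j))
  have hanti : Antitone E := fun m n hmn ω h j hj => h j (Finset.range_mono hmn hj)
  have heq : P {ω | y < ⨅ j, max (τ j ω - A j ω) 0} = P (⋂ n, E n) := by
    refine measure_congr ?_
    filter_upwards [hτ.ae_tendsto_max hA h0 h1] with ω hω
    refine propext ?_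
    change y < ⨅ j, max (τ j ω - A j ω) 0 ↔ ω ∈ ⋂ n, E n
    rw [lt_ciInf_iff_of_tendsto_cofinite hω]
    simp only [Set.mem_iInter]
    exact ⟨fun h n j _ => h j, fun h j => h (j + 1) j (Finset.self_mem_range_succ j)⟩
  have hlim := tendsto_measure_iInter_atTop (μ := P) (fun n => (hEm n).nullMeasurableSet) hanti
    ⟨0, measure_ne_top _ _⟩
  have hlim2 := hτ.tendsto_lintegral_prod_Ico (measurable_survival h0 h1 y)
    (measurable_voidProb y) (survival_le_one h0 h1 y) (voidProb_le_one h0 y)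
    (expStep_voidProb h0 h1 y) (tendsto_voidProb y) (m := 0) (H := fun _ => 1) measurable_const
    (fun _ => le_rfl)
  rw [heq, ← voidProb_zero]
  simp only [one_mul, prevPoint, lintegral_const, measure_univ, mul_one,
    Nat.Ico_zero_eq_range] at hlim2
  refine tendsto_nhds_unique hlim (hlim2.congr fun n => ?_)
  exact (hτ.measure_forall_mem hA (fun _ => S) (fun _ => hSm) _).symm

/-- The minimum of the slacks has again a law of the form `messageLaw`. -/
lemma map_iInf_eq_messageLaw :
    P.map (fun ω => ⨅ j, max (τ j ω - A j ω) 0) = messageLaw (Real.exp (-c)) :=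
  map_eq_messageLaw (Real.exp_pos _).le (Real.exp_le_one_iff.2 (neg_nonpos.2 h0))
    (Measurable.iInf fun j => ((hτ.measurable j).sub (hA.measurable j)).max measurable_const)
    (hτ.measure_lt_iInf hA h0 h1)

/-- The probability that the `i`-th point and its mark are in given sets, while the minimum of the
other slacks exceeds `y`. -/
lemma measure_point_mem_and {B : Set ℝ} (hB : MeasurableSet B) (x y : ℝ) (i : ℕ) :
    P {ω | τ i ω ∈ B ∧ x < A i ω ∧ y < ⨅ j : {j // j ≠ i}, max (τ j ω - A j ω) 0} =
      ∫⁻ ω, (∏ j ∈ Finset.range i, survival c y (τ j ω)) *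
        (B.indicator (fun _ => messageLaw c (Set.Ioi x)) (τ i ω) * voidProb c y (τ i ω)) ∂P := by
  have hprob := isProbabilityMeasure_messageLaw h0 h1
  set S : ℕ → Set (ℝ × ℝ) := fun j =>
    if j = i then B ×ˢ Set.Ioi x else {q | y < max (q.1 - q.2) 0} with hS
  have hSm : ∀ j, MeasurableSet (S j) := fun j => by
    simp only [hS]
    split_ifs
    · exact hB.prod measurableSet_Ioi
    · exact measurableSet_lt measurable_const (by fun_prop)
  have hSi : ∀ z, messageLaw c (Prod.mk z ⁻¹' S i) =
      B.indicator (fun _ => messageLaw c (Set.Ioi x)) z := fun z => by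
    by_cases hz : z ∈ B <;> simp [hS, hz]
  have hSj : ∀ j, j ≠ i → ∀ z, messageLaw c (Prod.mk z ⁻¹' S j) = survival c y z :=
    fun j hj z => by simp only [hS, if_neg hj]; rfl
  set E : ℕ → Set Ω := fun n => {ω | ∀ j ∈ Finset.range n, (τ j ω, A j ω) ∈ S j} with hE
  have hEm : ∀ n, MeasurableSet (E n) := fun n => by
    have : E n = ⋂ j ∈ Finset.range n, (fun ω => (τ j ω, A j ω)) ⁻¹' S j := by ext; simp [hE]
    rw [this]
    exact Finset.measurableSet_biInter _ fun j _ =>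
      (hSm j).preimage ((hτ.measurable j).prodMk (hA.measurable j))
  have hanti : Antitone E := fun m n hmn ω h j hj => h j (Finset.range_mono hmn hj)
  have hne : Nonempty {j // j ≠ i} := ⟨⟨i + 1, by simp⟩⟩
  have heq : P {ω | τ i ω ∈ B ∧ x < A i ω ∧ y < ⨅ j : {j // j ≠ i}, max (τ j ω - A j ω) 0} =
      P (⋂ n, E n) := by
    refine measure_congr ?_
    filter_upwards [hτ.ae_tendsto_max hA h0 h1] with ω hω
    refine propext ?_
    change (τ i ω ∈ B ∧ x < A i ω ∧ y < ⨅ j : {j // j ≠ i}, max (τ j ω - A j ω) 0) ↔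
      ω ∈ ⋂ n, E n
    rw [lt_ciInf_iff_of_tendsto_cofinite (a := fun j : {j // j ≠ i} => max (τ j ω - A j ω) 0)
      (hω.comp Subtype.val_injective.tendsto_cofinite)]
    simp only [Set.mem_iInter]
    constructor
    · rintro ⟨ha, hb, hc⟩ n j _
      by_cases hj : j = i
      · subst hj
        simp [hS, ha, hb]
      · simpa [hS, hj] using hc ⟨j, hj⟩
    · intro h
      have h' : ∀ j, (τ j ω, A j ω) ∈ S j := fun j => h (j + 1) j (Finset.self_mem_range_succ j)
      have hi : τ i ω ∈ B ∧ x < A i ω := by simpa [hS] using h' i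
      exact ⟨hi.1, hi.2, fun ⟨j, hj⟩ => by simpa [hS, hj] using h' j⟩
  have hlim := tendsto_measure_iInter_atTop (μ := P) (fun n => (hEm n).nullMeasurableSet) hanti
    ⟨0, measure_ne_top _ _⟩
  have hsm := measurable_survival h0 h1 y
  have hBm : Measurable (B.indicator fun _ => messageLaw c (Set.Ioi x)) :=
    measurable_const.indicator hB
  have hlim2 := hτ.tendsto_lintegral_prod_Ico hsm
    (measurable_voidProb y) (survival_le_one h0 h1 y) (voidProb_le_one h0 y)
    (expStep_voidProb h0 h1 y) (tendsto_voidProb y) (m := i + 1)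
    (H := fun ω => (∏ j ∈ Finset.range i, survival c y (τ j ω)) *
      B.indicator (fun _ => messageLaw c (Set.Ioi x)) (τ i ω))
    ((Finset.measurable_fun_prod _ fun j hj => hsm.comp (measurable_past_point τ
      ((Finset.mem_range.1 hj).trans i.lt_succ_self))).mul
      (hBm.comp (measurable_past_point τ i.lt_succ_self)))
    (fun ω => mul_le_one' (Finset.prod_le_one' fun j _ => survival_le_one h0 h1 y _)
      ((Set.indicator_le_self _ _ _).trans prob_le_one))
  rw [heq]
  simp only [mul_assoc, show prevPoint τ (i + 1) = τ i from rfl] at hlim2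
  refine tendsto_nhds_unique hlim (hlim2.congr' ?_)
  · filter_upwards [eventually_ge_atTop (i + 1)] with n hn
    refine Eq.trans ?_ (hτ.measure_forall_mem hA S hSm _).symm
    refine lintegral_congr fun ω => ?_
    rw [← Finset.prod_range_mul_prod_Ico _ hn, Finset.prod_range_succ, hSi, mul_assoc]
    congr 1
    · exact Finset.prod_congr rfl fun j hj => (hSj j (Finset.mem_range.1 hj).ne _).symm
    · congr 1
      exact Finset.prod_congr rfl fun j hj =>
        (hSj j (Nat.lt_of_succ_le (Finset.mem_Ico.1 hj).1).ne' _).symm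

/-- The Palm formula: the points have intensity `1` on `(0, ∞)`, and given a point, its mark is
independent of the minimum of the slacks of the other points, which has the law of the minimum of
all slacks. -/
lemma tsum_measure_point_mem_and {B : Set ℝ} (hB : MeasurableSet B) (x y : ℝ) :
    ∑' i, P {ω | τ i ω ∈ B ∧ x < A i ω ∧ y < ⨅ j : {j // j ≠ i}, max (τ j ω - A j ω) 0} =
      volume (B ∩ Set.Ioi 0) * (messageLaw c (Set.Ioi x) * voidProb c y 0) := by
  have hprob := isProbabilityMeasure_messageLaw h0 h1
  -- the formula for sets of finite length
  have hbdd : ∀ B : Set ℝ, MeasurableSet B → volume (B ∩ Set.Ioi 0) ≠ ∞ →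
      ∑' i, P {ω | τ i ω ∈ B ∧ x < A i ω ∧ y < ⨅ j : {j // j ≠ i}, max (τ j ω - A j ω) 0} =
        volume (B ∩ Set.Ioi 0) * (messageLaw c (Set.Ioi x) * voidProb c y 0) := by
    intro B hB hfin
    have hB' := hB.inter (measurableSet_Ioi (a := (0 : ℝ)))
    have hpos : ∀ i, P {ω | τ i ω ∈ B ∧ x < A i ω ∧
          y < ⨅ j : {j // j ≠ i}, max (τ j ω - A j ω) 0} =
        P {ω | τ i ω ∈ B ∩ Set.Ioi 0 ∧ x < A i ω ∧
          y < ⨅ j : {j // j ≠ i}, max (τ j ω - A j ω) 0} := fun i => by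
      refine measure_congr ?_
      filter_upwards [hτ.ae_point_pos] with ω hω
      refine propext (and_congr_left fun _ => ?_)
      exact (and_iff_left (hω i)).symm
    simp_rw [hpos, fun i => hτ.measure_point_mem_and hA h0 h1 hB' x y i]
    rw [hτ.tsum_lintegral_prod_range (measurable_const.indicator hB')
      (measurable_survival h0 h1 y) (measurable_voidProb y) ?_ (survival_le_one h0 h1 y)
      (voidProb_le_one h0 y) (expStep_voidProb h0 h1 y), setLIntegral_indicator hB',
      setLIntegral_const, Set.inter_assoc, Set.inter_self, ← mul_assoc, mul_comm (volume _)]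
    rw [lintegral_indicator_const hB']
    exact ENNReal.mul_ne_top (measure_ne_top _ _) hfin
  -- both sides are measures in `B`
  set D : ℕ → Set Ω := fun i =>
    {ω | x < A i ω ∧ y < ⨅ j : {j // j ≠ i}, max (τ j ω - A j ω) 0} with hD
  have hL : ∀ B, MeasurableSet B →
      ∑' i, P {ω | τ i ω ∈ B ∧ x < A i ω ∧ y < ⨅ j : {j // j ≠ i}, max (τ j ω - A j ω) 0} =
        Measure.sum (fun i => (P.restrict (D i)).map (τ i)) B := fun B hB => by
    rw [Measure.sum_apply _ hB]
    refine tsum_congr fun i => ?_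
    rw [Measure.map_apply (hτ.measurable i) hB, Measure.restrict_apply (hτ.measurable i hB)]
    rfl
  have hR : ∀ B : Set ℝ, MeasurableSet B →
      volume (B ∩ Set.Ioi 0) * (messageLaw c (Set.Ioi x) * voidProb c y 0) =
      ((messageLaw c (Set.Ioi x) * voidProb c y 0) • volume.restrict (Set.Ioi 0)) B :=
    fun B hB => by
      rw [Measure.smul_apply, Measure.restrict_apply hB, smul_eq_mul, mul_comm]
  rw [hL B hB, hR B hB]
  congr 1
  refine Measure.ext_of_iUnion_eq_univ (iUnion_spanningSets (volume : Measure ℝ)) fun n => ?_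
  ext B hB
  have hm := hB.inter (measurableSet_spanningSets (volume : Measure ℝ) n)
  rw [Measure.restrict_apply hB, Measure.restrict_apply hB, ← hL _ hm, ← hR _ hm]
  refine hbdd _ hm (ne_top_of_le_ne_top (measure_spanningSets_lt_top (volume : Measure ℝ) n).ne
    (measure_mono fun _ h => h.1.2))

end IsPoissonProcess

end marking

/-! ### The recursion away from the root -/

/-- The minimum of the positive parts of `x j - a j`: the value on the edge to a vertex from its parent,
where the edges to its children have lengths `x` and carry the messages `a`. -/
noncomputable def childMin (x a : ℕ → ℝ) : ℝ := ⨅ j, max (x j - a j) 0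

lemma childMin_nonneg (x a : ℕ → ℝ) : 0 ≤ childMin x a :=
  Real.iInf_nonneg fun _ => le_max_right _ _

lemma childMin_anti (x : ℕ → ℝ) {a b : ℕ → ℝ} (h : ∀ j, a j ≤ b j) :
    childMin x b ≤ childMin x a :=
  ciInf_mono ⟨0, by rintro _ ⟨j, rfl⟩; exact le_max_right _ _⟩ fun j =>
    max_le_max (sub_le_sub_left (h j) _) le_rfl

/-- `M k v i` are messages from `v` to `i :: v` after `k` iterations, started from
nonnegative messages, where the edge between `v` and `i :: v` has length `x v i`. -/
structure IsDownRecursion (x : Word → ℕ → ℝ) (M : ℕ → Word → ℕ → ℝ) : Prop where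
  nonneg : ∀ v i, 0 ≤ M 0 v i
  step : ∀ k v i, M (k + 1) v i = childMin (x (i :: v)) (M k (i :: v))

/-- The messages from `v` to `i :: v` after `k` iterations, started from `0`. -/
noncomputable def zeroIter (x : Word → ℕ → ℝ) : ℕ → Word → ℕ → ℝ
  | 0 => fun _ _ => 0
  | k + 1 => fun v i => childMin (x (i :: v)) (zeroIter x k (i :: v))

/-- The limit of the messages started from `0`, as the supremum along the even iterations. -/
noncomputable def downLimit (x : Word → ℕ → ℝ) (v : Word) (i : ℕ) : ℝ :=
  ⨆ n, zeroIter x (2 * n) v i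

lemma isDownRecursion_zeroIter (x : Word → ℕ → ℝ) : IsDownRecursion x (zeroIter x) :=
  ⟨fun _ _ => le_rfl, fun _ _ _ => rfl⟩

namespace IsDownRecursion

variable {x : Word → ℕ → ℝ} {M : ℕ → Word → ℕ → ℝ}

lemma nonneg_iterate (hM : IsDownRecursion x M) (k : ℕ) (v : Word) (i : ℕ) : 0 ≤ M k v i := by
  cases k with
  | zero => exact hM.nonneg v i
  | succ k => exact hM.step k v i ▸ childMin_nonneg _ _

lemma shift (hM : IsDownRecursion x M) (m : ℕ) : IsDownRecursion x fun k => M (k + m) :=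
  ⟨fun v i => hM.nonneg_iterate _ v i, fun k v i => by rw [← hM.step]; congr 1; ring⟩

/-- Each step of the recursion is antitone, so the order between two solutions alternates. -/
lemma zeroIter_sandwich (hM : IsDownRecursion x M) (n : ℕ) :
    (∀ v i, zeroIter x (2 * n) v i ≤ M (2 * n) v i) ∧
      ∀ v i, M (2 * n + 1) v i ≤ zeroIter x (2 * n + 1) v i := by
  have hodd : ∀ n, (∀ v i, zeroIter x n v i ≤ M n v i) →
      ∀ v i, M (n + 1) v i ≤ zeroIter x (n + 1) v i := fun n h v i => by
    rw [hM.step]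
    exact childMin_anti _ (h _)
  have heven : ∀ n, (∀ v i, M n v i ≤ zeroIter x n v i) →
      ∀ v i, zeroIter x (n + 1) v i ≤ M (n + 1) v i := fun n h v i => by
    rw [hM.step]
    exact childMin_anti _ (h _)
  induction n with
  | zero => exact ⟨hM.nonneg, hodd 0 hM.nonneg⟩
  | succ n ih => exact ⟨heven _ ih.2, hodd _ (heven _ ih.2)⟩

lemma zeroIter_even_le (hM : IsDownRecursion x M) {n k : ℕ} (h : 2 * n ≤ k) (v : Word) (i : ℕ) :
    zeroIter x (2 * n) v i ≤ M k v i := by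
  have := ((hM.shift (k - 2 * n)).zeroIter_sandwich n).1 v i
  rwa [Nat.add_sub_cancel' h] at this

lemma le_zeroIter_odd (hM : IsDownRecursion x M) {n k : ℕ} (h : 2 * n + 1 ≤ k) (v : Word)
    (i : ℕ) : M k v i ≤ zeroIter x (2 * n + 1) v i := by
  have := ((hM.shift (k - (2 * n + 1))).zeroIter_sandwich n).2 v i
  rwa [Nat.add_sub_cancel' h] at this

lemma le_zeroIter_one (hM : IsDownRecursion x M) {k : ℕ} (h : 1 ≤ k) (v : Word) (i : ℕ) :
    M k v i ≤ zeroIter x 1 v i :=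
  hM.le_zeroIter_odd (n := 0) h v i

end IsDownRecursion

lemma zeroIter_even_le_odd (x : Word → ℕ → ℝ) (m n : ℕ) (v : Word) (i : ℕ) :
    zeroIter x (2 * m) v i ≤ zeroIter x (2 * n + 1) v i := by
  have h := isDownRecursion_zeroIter x
  exact (h.zeroIter_even_le (k := 2 * (m + n)) (by lia) v i).trans
    ((h.zeroIter_even_le (k := 2 * (m + n) + 1) (by lia) v i).trans
      (h.le_zeroIter_odd (by lia) v i))

lemma bddAbove_zeroIter_even (x : Word → ℕ → ℝ) (v : Word) (i : ℕ) :
    BddAbove (Set.range fun n => zeroIter x (2 * n) v i) :=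
  ⟨zeroIter x (2 * 0 + 1) v i, by rintro _ ⟨n, rfl⟩; exact zeroIter_even_le_odd x n 0 v i⟩

lemma zeroIter_even_le_downLimit (x : Word → ℕ → ℝ) (n : ℕ) (v : Word) (i : ℕ) :
    zeroIter x (2 * n) v i ≤ downLimit x v i :=
  le_ciSup (bddAbove_zeroIter_even x v i) n

lemma downLimit_le_zeroIter_odd (x : Word → ℕ → ℝ) (n : ℕ) (v : Word) (i : ℕ) :
    downLimit x v i ≤ zeroIter x (2 * n + 1) v i :=
  ciSup_le fun m => zeroIter_even_le_odd x m n v i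

lemma downLimit_nonneg (x : Word → ℕ → ℝ) (v : Word) (i : ℕ) : 0 ≤ downLimit x v i :=
  zeroIter_even_le_downLimit x 0 v i

/-- No gap is left between the even and the odd iterations started from `0`. -/
def IsSqueezed (x : Word → ℕ → ℝ) : Prop :=
  ∀ v i (q : ℚ), ∃ n, (q : ℝ) < zeroIter x (2 * n) v i ∨ zeroIter x (2 * n + 1) v i ≤ q

namespace IsSqueezed

variable {x : Word → ℕ → ℝ} (hx : IsSqueezed x)
include hx

lemma exists_zeroIter_odd_lt {v : Word} {i : ℕ} {b : ℝ} (hb : downLimit x v i < b) :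
    ∃ n, zeroIter x (2 * n + 1) v i < b := by
  obtain ⟨q, hq1, hq2⟩ := exists_rat_btwn hb
  obtain ⟨n, hn | hn⟩ := hx v i q
  · exact absurd (hn.trans_le (zeroIter_even_le_downLimit x n v i)) (not_lt.2 hq1.le)
  · exact ⟨n, hn.trans_lt hq2⟩

lemma tendsto {M : ℕ → Word → ℕ → ℝ} (hM : IsDownRecursion x M) (v : Word) (i : ℕ) :
    Tendsto (fun k => M k v i) atTop (𝓝 (downLimit x v i)) := by
  refine tendsto_order.2 ⟨fun a ha => ?_, fun b hb => ?_⟩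
  · obtain ⟨n, hn⟩ := exists_lt_of_lt_ciSup ha
    filter_upwards [eventually_ge_atTop (2 * n)] with k hk
    exact hn.trans_le (hM.zeroIter_even_le hk v i)
  · obtain ⟨n, hn⟩ := hx.exists_zeroIter_odd_lt hb
    filter_upwards [eventually_ge_atTop (2 * n + 1)] with k hk
    exact (hM.le_zeroIter_odd hk v i).trans_lt hn

lemma eq_downLimit {m : Word → ℕ → ℝ} (hm : ∀ v i, m v i = childMin (x (i :: v)) (m (i :: v)))
    (v : Word) (i : ℕ) : m v i = downLimit x v i := by
  have hM : IsDownRecursion x fun _ => m :=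
    ⟨fun v i => hm v i ▸ childMin_nonneg _ _, fun _ => hm⟩
  exact tendsto_nhds_unique tendsto_const_nhds (hx.tendsto hM v i)

lemma downLimit_eq_childMin (v : Word) (i : ℕ) :
    downLimit x v i = childMin (x (i :: v)) (downLimit x (i :: v)) := by
  refine le_antisymm (ciSup_le fun n => ?_) (le_of_forall_gt_imp_ge_of_dense fun b hb => ?_)
  · have h := (isDownRecursion_zeroIter x).zeroIter_even_le (n := n) (k := 2 * n + 1 + 1) (by lia)
    refine (h v i).trans ?_
    exact childMin_anti _ fun j => downLimit_le_zeroIter_odd x n _ j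
  · obtain ⟨n, hn⟩ := hx.exists_zeroIter_odd_lt hb
    exact (childMin_anti _ fun j => zeroIter_even_le_downLimit x n _ j).trans hn.le

end IsSqueezed

/-! ### Neighbourhoods in the tree of words -/

lemma adj_child (v : Word) (i : ℕ) : wordTree.Adj v (i :: v) := Or.inl ⟨i, rfl⟩

lemma adj_parent (v : Word) (i : ℕ) : wordTree.Adj (i :: v) v := Or.inr ⟨i, rfl⟩

lemma adj_nil_iff {u : Word} : wordTree.Adj [] u ↔ ∃ i, u = [i] := by
  simp [wordTree]

lemma bpUpdate_child (cost m : Word → Word → ℝ) (v : Word) (i : ℕ) :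
    bpUpdate wordTree cost m v (i :: v) =
      childMin (fun j => cost (i :: v) (j :: i :: v)) (fun j => m (i :: v) (j :: i :: v)) := by
  let e : ℕ → {u : Word // wordTree.Adj (i :: v) u ∧ u ≠ v} := fun j =>
    ⟨j :: i :: v, adj_child _ j, fun h => by
      have := congrArg List.length h
      simp only [List.length_cons] at this
      lia⟩
  have he : Function.Surjective e := by
    rintro ⟨u, ⟨j, rfl⟩ | ⟨j, hj⟩, hu⟩
    · exact ⟨j, rfl⟩
    · exact absurd (List.cons.inj hj).2.symm hu
  exact (he.iInf_comp fun u => max (cost (i :: v) u - m (i :: v) u) 0).symm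

lemma bpUpdate_root (cost m : Word → Word → ℝ) (i : ℕ) :
    bpUpdate wordTree cost m [i] [] =
      ⨅ j : {j // j ≠ i}, max (cost [] [j.1] - m [] [j.1]) 0 := by
  let e : {j // j ≠ i} → {u : Word // wordTree.Adj [] u ∧ u ≠ [i]} := fun j =>
    ⟨[j.1], adj_child [] j, fun h => j.2 (List.cons.inj h).1⟩
  have he : Function.Surjective e := by
    rintro ⟨u, hu, hne⟩
    obtain ⟨j, rfl⟩ := adj_nil_iff.1 hu
    exact ⟨⟨j, fun h => hne (h ▸ rfl)⟩, rfl⟩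
  exact (he.iInf_comp fun u => max (cost [] u - m [] u) 0).symm

lemma mem_argminNeighbors_root {cost m : Word → Word → ℝ} {u : Word} :
    u ∈ argminNeighbors wordTree cost m [] ↔ ∃ i, u = [i] ∧
      ∀ j, max (cost [] [i] - m [] [i]) 0 ≤ max (cost [] [j] - m [] [j]) 0 := by
  constructor
  · rintro ⟨hu, h⟩
    obtain ⟨i, rfl⟩ := adj_nil_iff.1 hu
    exact ⟨i, rfl, fun j => h _ (adj_child [] j)⟩
  · rintro ⟨i, rfl, h⟩
    refine ⟨adj_child [] i, fun u' hu' => ?_⟩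
    obtain ⟨j, rfl⟩ := adj_nil_iff.1 hu'
    exact h j

section pwit

variable {Ω : Type*} (ξ : Word → ℕ → Ω → ℝ)

lemma pwitLength_child (ω : Ω) (v : Word) (i : ℕ) : pwitLength ξ ω v (i :: v) = ξ v i ω :=
  (edgeLength_child _ v i).1

lemma pwitLength_parent (ω : Ω) (v : Word) (i : ℕ) : pwitLength ξ ω (i :: v) v = ξ v i ω :=
  (edgeLength_child _ v i).2

lemma isDownRecursion_pwitMessage {X₀ : Word → Word → Ω → ℝ} {ω : Ω}
    (h : ∀ v i, 0 ≤ X₀ v (i :: v) ω) :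
    IsDownRecursion (fun v i => ξ v i ω) fun k v i => pwitMessage ξ X₀ k v (i :: v) ω := by
  refine ⟨h, fun k v i => ?_⟩
  refine (bpUpdate_child _ _ v i).trans ?_
  simp only [pwitLength_child]
  rfl

/-! ### The stationary process -/

/-- The messages towards the root, from `i :: v` to `v`, computed from the messages `D v i` from
`v` to `i :: v` by recursion on the depth. At the root the value is irrelevant. -/
noncomputable def upMessage (D : Word → ℕ → Ω → ℝ) : Word → Ω → ℝ
  | [] => 0
  | i :: v => fun ω => ⨅ u : {u // wordTree.Adj v u ∧ u ≠ i :: v},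
      max (pwitLength ξ ω v u -
        if v.length < u.1.length then D v (u.1.headD 0) ω else upMessage D v ω) 0

/-- The stationary process: the limit of the messages started from `0` on the edges directed away
from the root, extended by the recursion to the edges directed towards it. -/
noncomputable def limitProcess (u v : Word) (ω : Ω) : ℝ :=
  if u.length < v.length then downLimit (fun w j => ξ w j ω) u (v.headD 0)
  else upMessage ξ (fun w j ω => downLimit (fun w j => ξ w j ω) w j) u ω

lemma limitProcess_child (v : Word) (i : ℕ) (ω : Ω) :
    limitProcess ξ v (i :: v) ω = downLimit (fun w j => ξ w j ω) v i := by
  simp [limitProcess]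

lemma limitProcess_parent (v : Word) (i : ℕ) (ω : Ω) :
    limitProcess ξ (i :: v) v ω =
      bpUpdate wordTree (pwitLength ξ ω) (fun a b => limitProcess ξ a b ω) (i :: v) v := by
  simp [limitProcess, bpUpdate, upMessage]

lemma limitProcess_recursion {ω : Ω} (hω : IsSqueezed fun w j => ξ w j ω) {u v : Word}
    (huv : wordTree.Adj u v) : limitProcess ξ u v ω =
      bpUpdate wordTree (pwitLength ξ ω) (fun a b => limitProcess ξ a b ω) u v := by
  rcases huv with ⟨i, rfl⟩ | ⟨i, rfl⟩
  · rw [bpUpdate_child, limitProcess_child, hω.downLimit_eq_childMin]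
    simp only [pwitLength_child, limitProcess_child]
  · exact limitProcess_parent ξ v i ω

/-- A solution of the recursion on all directed edges is the limit process. -/
lemma eq_limitProcess {ω : Ω} (hω : IsSqueezed fun w j => ξ w j ω) {Y : Word → Word → ℝ}
    (hY : ∀ u v, wordTree.Adj u v → Y u v = bpUpdate wordTree (pwitLength ξ ω) Y u v)
    {u v : Word} (huv : wordTree.Adj u v) : Y u v = limitProcess ξ u v ω := by
  have hdown : ∀ v i, Y v (i :: v) = limitProcess ξ v (i :: v) ω := by
    intro v i
    rw [limitProcess_child]
    refine hω.eq_downLimit (m := fun v i => Y v (i :: v)) (fun v i => ?_) v i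
    rw [hY _ _ (adj_child v i), bpUpdate_child]
    simp only [pwitLength_child]
  have hup : ∀ v i, Y (i :: v) v = limitProcess ξ (i :: v) v ω := by
    intro v
    induction v with
    | nil =>
      intro i
      rw [hY _ _ (adj_parent [] i), limitProcess_parent]
      refine iInf_congr ?_
      rintro ⟨u, hu, -⟩
      obtain ⟨j, rfl⟩ := adj_nil_iff.1 hu
      simp only [hdown]
    | cons k v ih =>
      intro i
      rw [hY _ _ (adj_parent (k :: v) i), limitProcess_parent]
      refine iInf_congr ?_
      rintro ⟨u, ⟨j, rfl⟩ | ⟨j, hj⟩, -⟩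
      · simp only [hdown]
      · obtain ⟨rfl, rfl⟩ := List.cons.inj hj
        simp only [ih]
  rcases huv with ⟨i, rfl⟩ | ⟨i, rfl⟩
  · exact hdown u i
  · exact hup v i

end pwit

/-! ### Stability of the minimizers -/

/-- If the sequences `s k` converge to `a` at each index and dominate a sequence tending to
infinity, and if `a` has neither zeros nor repeated values, then the minimizers of the positive part
of `s k` are eventually those of the positive part of `a`. -/
lemma eventually_argmin_iff {a b : ℕ → ℝ} {s : ℕ → ℕ → ℝ} (hb : Tendsto b atTop atTop)
    (hbs : ∀ᶠ k in atTop, ∀ j, b j ≤ s k j) (hs : ∀ j, Tendsto (fun k => s k j) atTop (𝓝 (a j)))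
    (h0 : ∀ i, a i ≠ 0) (hinj : ∀ i j, i ≠ j → a i ≠ a j) :
    ∀ᶠ k in atTop, ∀ i, (∀ j, max (s k i) 0 ≤ max (s k j) 0) ↔
      ∀ j, max (a i) 0 ≤ max (a j) 0 := by
  have hmax : ∀ x y : ℝ, max x 0 ≤ max y 0 ↔ x ≤ 0 ∨ x ≤ y := fun x y => by
    rcases le_or_gt x 0 with h | h
    · simp [h]
    · simpa [h.not_ge] using h.le.trans
  have hba : ∀ j, b j ≤ a j := fun j => ge_of_tendsto (hs j) (hbs.mono fun k h => h j)
  -- only the indices in a finite set compete with the index `0`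
  set C : ℝ := max (a 0) 0 + 1 with hC
  have hC0 : a 0 < C := by linarith [le_max_left (a 0) 0]
  have hCpos : 0 < C := by linarith [le_max_right (a 0) 0]
  have hfin : {j | b j ≤ C}.Finite := by
    have : ∀ᶠ j in cofinite, C < b j := by
      rw [Nat.cofinite_eq_atTop]
      exact hb.eventually_gt_atTop C
    simpa [Filter.eventually_cofinite] using this
  have h0F : (0 : ℕ) ∈ {j | b j ≤ C} := (hba 0).trans hC0.le
  have hsign : ∀ᶠ k in atTop, ∀ i ∈ {j | b j ≤ C}, (s k i ≤ 0 ↔ a i ≤ 0) := by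
    refine (hfin.eventually_all).2 fun i _ => ?_
    rcases lt_or_gt_of_ne (h0 i) with h | h
    · filter_upwards [(hs i).eventually_lt_const h] with k hk
      simp [hk.le, h.le]
    · filter_upwards [(hs i).eventually_const_lt h] with k hk
      simp [hk.not_ge, h.not_ge]
  have hord : ∀ᶠ k in atTop, ∀ i ∈ {j | b j ≤ C}, ∀ j ∈ {j | b j ≤ C},
      (s k i ≤ s k j ↔ a i ≤ a j) := by
    refine (hfin.eventually_all).2 fun i _ => (hfin.eventually_all).2 fun j _ => ?_
    by_cases hij : i = j
    · simp [hij]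
    rcases lt_or_gt_of_ne (hinj i j hij) with h | h
    · filter_upwards [(hs i).eventually_lt (hs j) h] with k hk
      simp [hk.le, h.le]
    · filter_upwards [(hs j).eventually_lt (hs i) h] with k hk
      simp [hk.not_ge, h.not_ge]
  filter_upwards [hbs, hsign, hord, (hs 0).eventually_lt_const hC0] with k hk1 hk2 hk3 hk4
  -- comparison with all indices amounts to comparison within the finite set
  have hred : ∀ c : ℕ → ℝ, (∀ j, b j ≤ c j) → c 0 < C → ∀ i, (∀ j, max (c i) 0 ≤ max (c j) 0) ↔
      b i ≤ C ∧ ∀ j ∈ {j | b j ≤ C}, c i ≤ 0 ∨ c i ≤ c j := by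
    intro c hbc hc0 i
    constructor
    · intro h
      refine ⟨?_, fun j _ => (hmax _ _).1 (h j)⟩
      have : max (c i) 0 ≤ C := (h 0).trans (max_le hc0.le hCpos.le)
      exact (hbc i).trans ((le_max_left _ _).trans this)
    · rintro ⟨-, h⟩ j
      by_cases hj : b j ≤ C
      · exact (hmax _ _).2 (h j hj)
      · refine ((hmax _ _).2 (h 0 h0F)).trans ?_
        exact (max_le hc0.le hCpos.le).trans ((not_le.1 hj).le.trans
          ((hbc j).trans (le_max_left _ _)))
  rw [forall_congr' fun i => iff_congr (hred (s k) hk1 hk4 i) (hred a hba hC0 i)]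
  intro i
  refine and_congr_right fun hi => forall₂_congr fun j hj => ?_
  rw [hk2 i hi, hk3 i hi j hj]

/-! ### The parameters of the message laws -/

/-- The messages started from `0` have law `messageLaw (tailCoeff k)` after `k` iterations. -/
noncomputable def tailCoeff : ℕ → ℝ
  | 0 => 0
  | k + 1 => Real.exp (-tailCoeff k)

lemma tailCoeff_mem (k : ℕ) : 0 ≤ tailCoeff k ∧ tailCoeff k ≤ 1 := by
  induction k with
  | zero => simp [tailCoeff]
  | succ k ih => exact ⟨(Real.exp_pos _).le, Real.exp_le_one_iff.2 (neg_nonpos.2 ih.1)⟩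

lemma exp_neg_lambertW : Real.exp (-lambertW 1) = lambertW 1 := by
  have h := (lambertW_spec zero_le_one).2
  rw [Real.exp_neg]
  exact (eq_inv_of_mul_eq_one_left h).symm

lemma lambertW_mem : 0 ≤ lambertW 1 ∧ lambertW 1 ≤ 1 := by
  have h := (lambertW_spec zero_le_one).1
  exact ⟨h, exp_neg_lambertW ▸ Real.exp_le_one_iff.2 (neg_nonpos.2 h)⟩

lemma abs_exp_neg_sub_exp_neg_le {a b d : ℝ} (ha : d ≤ a) (hb : d ≤ b) :
    |Real.exp (-a) - Real.exp (-b)| ≤ Real.exp (-d) * |a - b| := by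
  wlog hab : a ≤ b generalizing a b
  · rw [abs_sub_comm, abs_sub_comm a]
    exact this hb ha (le_of_not_ge hab)
  have h1 := Real.add_one_le_exp (a - b)
  have h2 : Real.exp (-b) = Real.exp (-a) * Real.exp (a - b) := by
    rw [← Real.exp_add]; ring_nf
  have h3 : Real.exp (-a) ≤ Real.exp (-d) := Real.exp_le_exp.2 (by linarith)
  have h4 : Real.exp (-b) ≤ Real.exp (-a) := Real.exp_le_exp.2 (by linarith)
  rw [abs_of_nonneg (by linarith), abs_of_nonpos (by linarith)]
  calc Real.exp (-a) - Real.exp (-b) = Real.exp (-a) * (1 - Real.exp (a - b)) := by rw [h2]; ring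
    _ ≤ Real.exp (-a) * (-(a - b)) := by
      gcongr
      linarith
    _ ≤ _ := mul_le_mul_of_nonneg_right h3 (by linarith)

/-- From the first iterate on, `c ↦ exp (-c)` contracts towards its fixed point `W(1)`. -/
lemma tendsto_tailCoeff : Tendsto tailCoeff atTop (𝓝 (lambertW 1)) := by
  set r : ℝ := Real.exp (-Real.exp (-1)) with hr
  have hr1 : r < 1 := Real.exp_lt_one_iff.2 (neg_lt_zero.2 (Real.exp_pos _))
  have hW : Real.exp (-1) ≤ lambertW 1 := by
    rw [← exp_neg_lambertW]
    exact Real.exp_le_exp.2 (neg_le_neg lambertW_mem.2)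
  have hc : ∀ k, Real.exp (-1) ≤ tailCoeff (k + 1) := fun k =>
    Real.exp_le_exp.2 (neg_le_neg (tailCoeff_mem k).2)
  have hk : ∀ k, |tailCoeff (k + 1) - lambertW 1| ≤ r ^ k * |tailCoeff 1 - lambertW 1| := by
    intro k
    induction k with
    | zero => simp
    | succ k ih =>
      have h := abs_exp_neg_sub_exp_neg_le (hc k) hW
      rw [exp_neg_lambertW] at h
      calc _ ≤ r * |tailCoeff (k + 1) - lambertW 1| := h
        _ ≤ r * (r ^ k * |tailCoeff 1 - lambertW 1|) :=
          mul_le_mul_of_nonneg_left ih (Real.exp_pos _).le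
        _ = _ := by ring
  refine (tendsto_add_atTop_iff_nat 1).1 (tendsto_iff_norm_sub_tendsto_zero.2 ?_)
  refine squeeze_zero (fun _ => norm_nonneg _) hk ?_
  simpa using (tendsto_pow_atTop_nhds_zero_of_lt_one (Real.exp_pos _).le hr1).mul_const
    |tailCoeff 1 - lambertW 1|

/-! ### Independence of the messages in disjoint subtrees -/

section treeSigma

variable {Ω : Type*}

/-- The words that descend from `u`, including `u`. -/
def subtree (u : Word) : Set Word := {w | u <:+ w}

/-- The σ-algebra generated by the lengths of the edges from the vertices in `S` to their
children. -/
abbrev treeSigma (ξ : Word → ℕ → Ω → ℝ) (S : Set Word) : MeasurableSpace Ω :=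
  ⨆ w ∈ S, MeasurableSpace.comap (fun ω i => ξ w i ω) inferInstance

variable (ξ : Word → ℕ → Ω → ℝ)

lemma treeSigma_mono {S T : Set Word} (h : S ⊆ T) : treeSigma ξ S ≤ treeSigma ξ T :=
  biSup_mono h

lemma measurable_treeSigma_length {S : Set Word} {w : Word} (hw : w ∈ S) (i : ℕ) :
    Measurable[treeSigma ξ S] (ξ w i) := by
  have h1 : Measurable[treeSigma ξ S] fun ω i => ξ w i ω :=
    (comap_measurable (fun ω i => ξ w i ω)).mono
      (le_biSup (fun w => MeasurableSpace.comap (fun ω i => ξ w i ω) inferInstance) hw) le_rfl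
  exact (measurable_pi_apply i).comp h1

lemma mem_subtree_self (u : Word) : u ∈ subtree u := List.suffix_rfl

lemma subtree_child_subset (u : Word) (j : ℕ) : subtree (j :: u) ⊆ subtree u :=
  fun _ h => (List.suffix_cons j u).trans h

lemma notMem_subtree_child (u : Word) (j : ℕ) : u ∉ subtree (j :: u) := fun h => by
  have := List.IsSuffix.length_le h
  simp at this

lemma disjoint_subtree_child {u : Word} {i j : ℕ} (hij : i ≠ j) :
    Disjoint (subtree (i :: u)) (subtree (j :: u)) := by
  refine Set.disjoint_left.2 fun w hi hj => hij ?_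
  have h := (List.suffix_of_suffix_length_le hi hj le_rfl).eq_of_length rfl
  exact (List.cons.inj h).1

lemma measurable_childMin {m : MeasurableSpace Ω} {x a : ℕ → Ω → ℝ}
    (hx : ∀ j, Measurable[m] (x j)) (ha : ∀ j, Measurable[m] (a j)) :
    Measurable[m] fun ω => childMin (fun j => x j ω) (fun j => a j ω) :=
  Measurable.iInf fun j => ((hx j).sub (ha j)).max measurable_const

lemma measurable_zeroIter (k : ℕ) (v : Word) (i : ℕ) :
    Measurable[treeSigma ξ (subtree (i :: v))] fun ω => zeroIter (fun w j => ξ w j ω) k v i := by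
  induction k generalizing v i with
  | zero => exact measurable_const
  | succ k ih =>
    exact measurable_childMin (fun j => measurable_treeSigma_length ξ (mem_subtree_self _) j)
      fun j => (ih (i :: v) j).mono (treeSigma_mono ξ (subtree_child_subset _ _)) le_rfl

lemma measurable_downLimit (v : Word) (i : ℕ) :
    Measurable[treeSigma ξ (subtree (i :: v))] fun ω => downLimit (fun w j => ξ w j ω) v i :=
  Measurable.iSup fun _ => measurable_zeroIter ξ _ v i

lemma measurable_limitProcess_child (v : Word) (i : ℕ) :
    Measurable[treeSigma ξ (subtree (i :: v))] (limitProcess ξ v (i :: v)) := by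
  have : limitProcess ξ v (i :: v) = fun ω => downLimit (fun w j => ξ w j ω) v i :=
    funext (limitProcess_child ξ v i)
  exact this ▸ measurable_downLimit ξ v i

lemma measurable_limitProcess_parent (v : Word) (i : ℕ) :
    Measurable[treeSigma ξ (subtree (i :: v))ᶜ] (limitProcess ξ (i :: v) v) := by
  have hparent : ∀ v i, limitProcess ξ (i :: v) v =
      fun ω => ⨅ u : {u // wordTree.Adj v u ∧ u ≠ i :: v},
        max (pwitLength ξ ω v u - limitProcess ξ v u ω) 0 := fun v i =>
    funext (limitProcess_parent ξ v i)
  have hv : v ∈ (subtree (i :: v))ᶜ := notMem_subtree_child v i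
  have hchild : ∀ v i j, j ≠ i →
      Measurable[treeSigma ξ (subtree (i :: v))ᶜ] (limitProcess ξ v (j :: v)) := fun v i j hj =>
    (measurable_limitProcess_child ξ v j).mono (treeSigma_mono ξ
      (Set.subset_compl_iff_disjoint_right.2 (disjoint_subtree_child hj))) le_rfl
  have hlen : ∀ v i j, Measurable[treeSigma ξ (subtree (i :: v))ᶜ]
      fun ω => pwitLength ξ ω v (j :: v) := fun v i j => by
    simp only [pwitLength_child]
    exact measurable_treeSigma_length ξ (notMem_subtree_child v i) j
  induction v generalizing i with
  | nil =>
    rw [hparent]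
    refine Measurable.iInf ?_
    rintro ⟨u, hu, hne⟩
    obtain ⟨j, rfl⟩ := adj_nil_iff.1 hu
    exact ((hlen [] i j).sub (hchild [] i j fun h => hne (h ▸ rfl))).max measurable_const
  | cons k v ih =>
    rw [hparent]
    refine Measurable.iInf ?_
    rintro ⟨u, ⟨j, rfl⟩ | ⟨j, hj⟩, hne⟩
    · exact ((hlen _ i j).sub (hchild _ i j fun h => hne (h ▸ rfl))).max measurable_const
    · obtain ⟨rfl, rfl⟩ := List.cons.inj hj
      have hsub : (subtree (k :: v))ᶜ ⊆ (subtree (i :: k :: v))ᶜ :=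
        Set.compl_subset_compl.2 (subtree_child_subset _ _)
      simp only [pwitLength_parent]
      exact ((measurable_treeSigma_length ξ (hsub (notMem_subtree_child v k)) k).sub
        ((ih k (notMem_subtree_child v k)).mono (treeSigma_mono ξ hsub) le_rfl)).max
        measurable_const

end treeSigma

namespace IsPWIT

variable {Ω : Type*} [MeasurableSpace Ω] {P : Measure Ω} [IsProbabilityMeasure P]
  {ξ : Word → ℕ → Ω → ℝ} (hξ : IsPWIT P ξ)
include hξ

omit [IsProbabilityMeasure P] in
lemma comap_le (w : Word) :
    MeasurableSpace.comap (fun ω i => ξ w i ω) inferInstance ≤ ‹MeasurableSpace Ω› :=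
  (measurable_pi_lambda _ (hξ.poisson w).measurable).comap_le

omit [IsProbabilityMeasure P] in
lemma treeSigma_le (S : Set Word) : treeSigma ξ S ≤ ‹MeasurableSpace Ω› :=
  iSup₂_le fun w _ => hξ.comap_le w

omit [IsProbabilityMeasure P] in
lemma indepFun_of_disjoint {S T : Set Word} (hST : Disjoint S T) {α β : Type*}
    [MeasurableSpace α] [MeasurableSpace β] {U : Ω → α} {V : Ω → β}
    (hU : Measurable[treeSigma ξ S] U) (hV : Measurable[treeSigma ξ T] V) : IndepFun U V P :=
  indep_of_indep_of_le_left (indep_of_indep_of_le_right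
    (indep_iSup_of_disjoint hξ.comap_le hξ.indep hST) hV.comap_le) hU.comap_le

omit [IsProbabilityMeasure P] in
/-- Messages that depend only on the subtrees below the children of `w` are marks for the
lengths of the edges from `w` to its children. -/
lemma isMarking {w : Word} {A : ℕ → Ω → ℝ} {c : ℝ}
    (hA : ∀ j, Measurable[treeSigma ξ (subtree (j :: w))] (A j))
    (hlaw : ∀ j, P.map (A j) = messageLaw c) : IsMarking P (ξ w) A c := by
  refine ⟨fun j => (hA j).mono (hξ.treeSigma_le _) le_rfl, hlaw, ?_, ?_⟩
  · have h := iIndep_biSup_of_pairwise_disjoint hξ.comap_le hξ.indep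
      (S := fun j => subtree (j :: w)) fun i j hij => disjoint_subtree_child hij
    refine (iIndepFun_iff _ _ _).2 fun s f hf => ?_
    exact (iIndep_iff (fun j => treeSigma ξ (subtree (j :: w))) P).1 h s
      fun j hj => (hA j).comap_le _ (hf j hj)
  · have hsub : ∀ j, subtree (j :: w) ⊆ subtree w \ {w} := fun j u hu =>
      ⟨subtree_child_subset w j hu, by rintro rfl; exact notMem_subtree_child _ j hu⟩
    have hU : Measurable[treeSigma ξ {w}] fun ω i => ξ w i ω :=
      @measurable_pi_lambda _ _ _ (treeSigma ξ {w}) _ _ fun i =>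
        measurable_treeSigma_length ξ (Set.mem_singleton w) i
    have hV : Measurable[treeSigma ξ (subtree w \ {w})] fun ω j => A j ω :=
      @measurable_pi_lambda _ _ _ (treeSigma ξ (subtree w \ {w})) _ _ fun j =>
        (hA j).mono (treeSigma_mono ξ (hsub j)) le_rfl
    exact hξ.indepFun_of_disjoint Set.disjoint_sdiff_right hU hV

lemma map_zeroIter (k : ℕ) (v : Word) (i : ℕ) :
    P.map (fun ω => zeroIter (fun w j => ξ w j ω) k v i) = messageLaw (tailCoeff k) := by
  induction k generalizing v i with
  | zero => simp [zeroIter, tailCoeff, messageLaw]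
  | succ k ih =>
    exact (hξ.poisson (i :: v)).map_iInf_eq_messageLaw
      (hξ.isMarking (fun j => measurable_zeroIter ξ k (i :: v) j) fun j => ih (i :: v) j)
      (tailCoeff_mem k).1 (tailCoeff_mem k).2

lemma measure_lt_zeroIter (k : ℕ) (v : Word) (i : ℕ) (y : ℝ) :
    P {ω | y < zeroIter (fun w j => ξ w j ω) k v i} =
      if 0 ≤ y then ENNReal.ofReal (tailCoeff k * Real.exp (-y)) else 1 := by
  rw [← messageLaw_Ioi (tailCoeff_mem k).1 (tailCoeff_mem k).2, ← hξ.map_zeroIter k v i,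
    Measure.map_apply ((measurable_zeroIter ξ k v i).mono (hξ.treeSigma_le _) le_rfl)
      measurableSet_Ioi]
  rfl

/-- The even and the odd iterates started from `0` are ordered and have the same limit in law, so
that they have the same limit. -/
lemma ae_isSqueezed : ∀ᵐ ω ∂P, IsSqueezed fun w j => ξ w j ω := by
  refine ae_all_iff.2 fun v => ae_all_iff.2 fun i => ae_all_iff.2 fun q => ?_
  have hm : ∀ k, Measurable fun ω => zeroIter (fun w j => ξ w j ω) k v i := fun k =>
    (measurable_zeroIter ξ k v i).mono (hξ.treeSigma_le _) le_rfl
  suffices hnull : P {ω | ∀ n, zeroIter (fun w j => ξ w j ω) (2 * n) v i ≤ q ∧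
      (q : ℝ) < zeroIter (fun w j => ξ w j ω) (2 * n + 1) v i} = 0 by
    filter_upwards [measure_eq_zero_iff_ae_notMem.1 hnull] with ω hω
    by_contra! hcon
    exact hω hcon
  have hle : ∀ n, P {ω | ∀ n, zeroIter (fun w j => ξ w j ω) (2 * n) v i ≤ q ∧
      (q : ℝ) < zeroIter (fun w j => ξ w j ω) (2 * n + 1) v i} ≤
      P {ω | (q : ℝ) < zeroIter (fun w j => ξ w j ω) (2 * n + 1) v i} -
        P {ω | (q : ℝ) < zeroIter (fun w j => ξ w j ω) (2 * n) v i} := by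
    intro n
    have hsub : {ω | (q : ℝ) < zeroIter (fun w j => ξ w j ω) (2 * n) v i} ⊆
        {ω | (q : ℝ) < zeroIter (fun w j => ξ w j ω) (2 * n + 1) v i} :=
      fun ω (h : (q : ℝ) < _) => lt_of_lt_of_le h (zeroIter_even_le_odd _ n n v i)
    rw [← measure_sdiff hsub (measurableSet_lt measurable_const (hm _)).nullMeasurableSet
      (measure_ne_top _ _)]
    exact measure_mono fun ω h => ⟨(h n).2, not_lt.2 (h n).1⟩
  have hconv : ∀ y : ℝ, Tendsto (fun k => P {ω | y < zeroIter (fun w j => ξ w j ω) k v i}) atTop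
      (𝓝 (if 0 ≤ y then ENNReal.ofReal (lambertW 1 * Real.exp (-y)) else 1)) := fun y => by
    simp_rw [hξ.measure_lt_zeroIter]
    split_ifs
    · exact ENNReal.tendsto_ofReal (tendsto_tailCoeff.mul_const _)
    · exact tendsto_const_nhds
  have htop : (if (0 : ℝ) ≤ q then ENNReal.ofReal (lambertW 1 * Real.exp (-q)) else 1) ≠ ∞ := by
    split_ifs <;> simp
  have hodd := (hconv q).comp (tendsto_atTop_mono (fun n => by simp only [id]; lia) tendsto_id :
    Tendsto (fun n => 2 * n + 1) atTop atTop)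
  have heven := (hconv q).comp (tendsto_atTop_mono (fun n => by simp only [id]; lia) tendsto_id :
    Tendsto (fun n => 2 * n) atTop atTop)
  have h := ENNReal.Tendsto.sub hodd heven (Or.inl htop)
  rw [tsub_self] at h
  exact nonpos_iff_eq_zero.1 (ge_of_tendsto' h hle)

lemma measure_lt_downLimit (v : Word) (i : ℕ) (y : ℝ) :
    P {ω | y < downLimit (fun w j => ξ w j ω) v i} =
      if 0 ≤ y then ENNReal.ofReal (lambertW 1 * Real.exp (-y)) else 1 := by
  have heq : {ω | y < downLimit (fun w j => ξ w j ω) v i} =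
      ⋃ n, {ω | y < zeroIter (fun w j => ξ w j ω) (2 * n) v i} := by
    ext ω
    simp only [Set.mem_ofPred_eq, Set.mem_iUnion]
    exact lt_ciSup_iff (bddAbove_zeroIter_even _ v i)
  have hmono : Monotone fun n => {ω | y < zeroIter (fun w j => ξ w j ω) (2 * n) v i} :=
    fun a b hab ω (h : y < _) =>
      h.trans_le ((isDownRecursion_zeroIter _).zeroIter_even_le (by lia) v i)
  have h := tendsto_measure_iUnion_atTop (μ := P) hmono
  rw [← heq] at h
  refine tendsto_nhds_unique h ?_
  simp only [Function.comp_def, hξ.measure_lt_zeroIter]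
  split_ifs
  · exact ENNReal.tendsto_ofReal ((tendsto_tailCoeff.mul_const _).comp
      (tendsto_atTop_mono (fun n => by simp only [id]; lia) tendsto_id :
        Tendsto (fun n => 2 * n) atTop atTop))
  · exact tendsto_const_nhds

lemma map_downLimit (v : Word) (i : ℕ) :
    P.map (fun ω => downLimit (fun w j => ξ w j ω) v i) = messageLaw (lambertW 1) :=
  map_eq_messageLaw lambertW_mem.1 lambertW_mem.2
    ((measurable_downLimit ξ v i).mono (hξ.treeSigma_le _) le_rfl) (hξ.measure_lt_downLimit v i)

lemma isMarking_downLimit (w : Word) :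
    IsMarking P (ξ w) (fun j ω => downLimit (fun w j => ξ w j ω) w j) (lambertW 1) :=
  hξ.isMarking (fun j => measurable_downLimit ξ w j) (hξ.map_downLimit w)

omit [IsProbabilityMeasure P] hξ in
lemma ofReal_fixedTail (y : ℝ) : ENNReal.ofReal (fixedTail y) =
    if 0 ≤ y then ENNReal.ofReal (lambertW 1 * Real.exp (-y)) else 1 := by
  unfold fixedTail
  split_ifs <;> simp

lemma isStationaryProcess_limitProcess : IsStationaryProcess P ξ (limitProcess ξ) where
  aemeasurable := by
    rintro u v (⟨i, rfl⟩ | ⟨i, rfl⟩)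
    · exact ((measurable_limitProcess_child ξ u i).mono (hξ.treeSigma_le _) le_rfl).aemeasurable
    · exact ((measurable_limitProcess_parent ξ v i).mono (hξ.treeSigma_le _) le_rfl).aemeasurable
  recursion u v huv := hξ.ae_isSqueezed.mono fun ω hω => limitProcess_recursion ξ hω huv
  tail v i y := by
    simp only [limitProcess_child, hξ.measure_lt_downLimit, ofReal_fixedTail]
  indep := by
    rintro u v (⟨i, rfl⟩ | ⟨i, rfl⟩)
    · exact hξ.indepFun_of_disjoint disjoint_compl_right (measurable_limitProcess_child ξ u i)
        (measurable_limitProcess_parent ξ u i)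
    · exact hξ.indepFun_of_disjoint disjoint_compl_left (measurable_limitProcess_parent ξ v i)
        (measurable_limitProcess_child ξ v i)
  palm B hB x y := by
    -- the message from `[i]` to the root is the minimum of the slacks of the other root edges
    have h := (hξ.poisson []).tsum_measure_point_mem_and (hξ.isMarking_downLimit [])
      lambertW_mem.1 lambertW_mem.2 hB x y
    rw [messageLaw_Ioi lambertW_mem.1 lambertW_mem.2, voidProb_zero, exp_neg_lambertW,
      ← ofReal_fixedTail, ← ofReal_fixedTail] at h
    rw [← h]
    simp only [limitProcess_parent, bpUpdate_root, limitProcess_child, pwitLength_child]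

lemma ae_eq_limitProcess {Y : Word → Word → Ω → ℝ} (hY : IsStationaryProcess P ξ Y) {u v : Word}
    (huv : wordTree.Adj u v) : Y u v =ᵐ[P] limitProcess ξ u v := by
  have hall : ∀ᵐ ω ∂P, ∀ u v, wordTree.Adj u v →
      Y u v ω = bpUpdate wordTree (pwitLength ξ ω) (fun a b => Y a b ω) u v :=
    ae_all_iff.2 fun u => ae_all_iff.2 fun v => by
      by_cases h : wordTree.Adj u v
      · exact (hY.recursion u v h).mono fun ω hω _ => hω
      · exact ae_of_all _ fun ω h' => absurd h' h
  filter_upwards [hall, hξ.ae_isSqueezed] with ω h1 h2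
  exact eq_limitProcess ξ h2 (Y := fun a b => Y a b ω) h1 huv

/-! ### Convergence of belief propagation -/

lemma memLp_zeroIter_one (v : Word) (i : ℕ) :
    MemLp (fun ω => zeroIter (fun w j => ξ w j ω) 1 v i) 2 P := by
  have hm : Measurable fun ω => zeroIter (fun w j => ξ w j ω) 1 v i :=
    (measurable_zeroIter ξ 1 v i).mono (hξ.treeSigma_le _) le_rfl
  have hlaw : P.map (fun ω => zeroIter (fun w j => ξ w j ω) 1 v i) = expMeasure 1 := by
    rw [hξ.map_zeroIter]
    simp [tailCoeff, messageLaw]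
  have hexp : MemLp id 2 (expMeasure 1) := by
    refine (memLp_two_iff_integrable_sq aestronglyMeasurable_id).2
      ⟨by fun_prop, ?_⟩
    have hint : IntegrableOn (fun t : ℝ => 8 * Real.exp (-(1 / 2) * t)) (Set.Ioi 0) :=
      (exp_neg_integrableOn_Ioi 0 one_half_pos).const_mul 8
    rw [HasFiniteIntegral, lintegral_expMeasure_one _ (by fun_prop)]
    refine lt_of_le_of_lt (setLIntegral_mono (g := fun t => ‖8 * Real.exp (-(1 / 2) * t)‖ₑ)
      (by fun_prop) fun t ht => ?_) hint.2
    have ht : 0 < t := ht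
    simp only [id, Real.enorm_eq_ofReal (sq_nonneg t)]
    rw [Real.enorm_eq_ofReal (by positivity), ← ENNReal.ofReal_mul (Real.exp_pos _).le]
    refine ENNReal.ofReal_le_ofReal ?_
    have h1 := Real.quadratic_le_exp_of_nonneg (half_pos ht).le
    have h2 : Real.exp (-(1 / 2) * t) = Real.exp (-t) * Real.exp (t / 2) := by
      rw [← Real.exp_add]; ring_nf
    rw [h2]
    have h3 : t ^ 2 ≤ 8 * Real.exp (t / 2) := by nlinarith
    nlinarith [Real.exp_pos (-t)]
  rw [← hlaw] at hexp
  exact (memLp_map_measure_iff aestronglyMeasurable_id hm.aemeasurable).1 hexp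

lemma memLp_limitProcess_child (v : Word) (i : ℕ) : MemLp (limitProcess ξ v (i :: v)) 2 P := by
  refine (hξ.memLp_zeroIter_one v i).mono ((measurable_limitProcess_child ξ v i).mono
    (hξ.treeSigma_le _) le_rfl).aestronglyMeasurable (ae_of_all _ fun ω => ?_)
  have h0 := downLimit_nonneg (fun w j => ξ w j ω) v i
  have h1 := downLimit_le_zeroIter_odd (fun w j => ξ w j ω) 0 v i
  rw [limitProcess_child, Real.norm_of_nonneg h0, Real.norm_of_nonneg (h0.trans h1)]
  exact h1

lemma tendsto_eLpNorm_sub {M : ℕ → Ω → ℝ} {v : Word} {i : ℕ} (hMm : ∀ k, Measurable (M k))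
    (hM0 : ∀ k, ∀ᵐ ω ∂P, 0 ≤ M k ω)
    (hM1 : ∀ k, 1 ≤ k → ∀ᵐ ω ∂P, M k ω ≤ zeroIter (fun w j => ξ w j ω) 1 v i)
    (hlim : ∀ᵐ ω ∂P, Tendsto (fun k => M k ω) atTop (𝓝 (limitProcess ξ v (i :: v) ω))) :
    Tendsto (fun k => eLpNorm (fun ω => M k ω - limitProcess ξ v (i :: v) ω) 2 P) atTop
      (𝓝 0) := by
  have hXm : Measurable (limitProcess ξ v (i :: v)) :=
    (measurable_limitProcess_child ξ v i).mono (hξ.treeSigma_le _) le_rfl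
  have hsq := (memLp_two_iff_integrable_sq (hξ.memLp_zeroIter_one v i).1).1
    (hξ.memLp_zeroIter_one v i)
  have key : Tendsto (fun k => ∫⁻ ω, ‖M k ω - limitProcess ξ v (i :: v) ω‖ₑ ^ (2 : ℝ) ∂P)
      atTop (𝓝 0) := by
    rw [← lintegral_zero (μ := P)]
    refine tendsto_lintegral_filter_of_dominated_convergence
      (fun ω => ‖zeroIter (fun w j => ξ w j ω) 1 v i ^ 2‖ₑ)
      (Eventually.of_forall fun k => (((hMm k).sub hXm).enorm.pow_const _)) ?_ hsq.2.ne ?_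
    · filter_upwards [eventually_ge_atTop 1] with k hk
      filter_upwards [hM0 k, hM1 k hk] with ω h0 h1
      have h2 := limitProcess_child ξ v i ω ▸ downLimit_nonneg _ v i
      have h3 := limitProcess_child ξ v i ω ▸
        downLimit_le_zeroIter_odd (fun w j => ξ w j ω) 0 v i
      rw [enorm_pow, ENNReal.rpow_ofNat]
      gcongr
      refine enorm_le_iff_norm_le.2 (abs_le.2 ?_)
      rw [Real.norm_of_nonneg (h0.trans h1)]
      exact ⟨by linarith, by linarith⟩
    · filter_upwards [hlim] with ω hω
      have h1 : Tendsto (fun k => M k ω - limitProcess ξ v (i :: v) ω) atTop (𝓝 0) := by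
        simpa using hω.sub_const (limitProcess ξ v (i :: v) ω)
      have h2 := (ENNReal.continuous_rpow_const (y := 2)).tendsto _ |>.comp
        ((continuous_enorm.tendsto _).comp h1)
      simpa [Function.comp_def] using h2
  have h := (ENNReal.continuous_rpow_const (y := 1 / 2)).tendsto _ |>.comp key
  simp only [Function.comp_def] at h
  rw [ENNReal.zero_rpow_of_pos one_half_pos] at h
  refine h.congr fun k => ?_
  rw [eLpNorm_eq_lintegral_rpow_enorm_toReal two_ne_zero ENNReal.ofNat_ne_top]
  simp

end IsPWIT

section decision

variable {Ω : Type*} [MeasurableSpace Ω] {P : Measure Ω} [IsProbabilityMeasure P]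
  {ξ : Word → ℕ → Ω → ℝ} {ν : Measure ℝ} {X₀ : Word → Word → Ω → ℝ}

omit [IsProbabilityMeasure P] in
lemma IsIIDInit.ae_nonneg (hX : IsIIDInit P ξ ν X₀) (hν : ν (Set.Iio 0) = 0) :
    ∀ᵐ ω ∂P, ∀ v i, 0 ≤ X₀ v (i :: v) ω := by
  refine ae_all_iff.2 fun v => ae_all_iff.2 fun i => ?_
  rw [← hX.map_eq v i, Measure.map_apply (hX.measurable v i) measurableSet_Iio] at hν
  filter_upwards [measure_eq_zero_iff_ae_notMem.1 hν] with ω hω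
  simpa using hω

omit [IsProbabilityMeasure P] in
lemma IsIIDInit.measurable_pwitMessage (hX : IsIIDInit P ξ ν X₀)
    (hξ : ∀ v i, Measurable (ξ v i)) (k : ℕ) (v : Word) (i : ℕ) :
    Measurable (pwitMessage ξ X₀ k v (i :: v)) := by
  induction k generalizing v i with
  | zero => exact hX.measurable v i
  | succ k ih =>
    have h : pwitMessage ξ X₀ (k + 1) v (i :: v) = fun ω =>
        childMin (fun j => ξ (i :: v) j ω)
          fun j => pwitMessage ξ X₀ k (i :: v) (j :: i :: v) ω := by
      funext ω
      refine (bpUpdate_child _ _ v i).trans ?_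
      simp only [pwitLength_child]
      rfl
    rw [h]
    exact measurable_childMin (hξ (i :: v)) (ih (i :: v))

lemma measurableSet_forall_max_le {a : ℕ → Ω → ℝ} (ha : ∀ j, Measurable (a j)) (i : ℕ) :
    MeasurableSet {ω | ∀ j, max (a i ω) 0 ≤ max (a j ω) 0} := by
  rw [Set.ofPred_forall]
  exact MeasurableSet.iInter fun j => measurableSet_le ((ha i).max measurable_const)
    ((ha j).max measurable_const)

omit [MeasurableSpace Ω] in
lemma mem_pwitDecision_root {k : ℕ} {u : Word} {ω : Ω} : u ∈ pwitDecision ξ X₀ k [] ω ↔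
    ∃ i, u = [i] ∧ ∀ j, max (ξ [] i ω - pwitMessage ξ X₀ k [] [i] ω) 0 ≤
      max (ξ [] j ω - pwitMessage ξ X₀ k [] [j] ω) 0 := by
  simp only [pwitDecision, mem_argminNeighbors_root, pwitLength_child]

omit [MeasurableSpace Ω] in
lemma mem_coptAt_root {X : Word → Word → Ω → ℝ} {u : Word} {ω : Ω} : u ∈ coptAt ξ X [] ω ↔
    ∃ i, u = [i] ∧ ∀ j, max (ξ [] i ω - X [] [i] ω) 0 ≤ max (ξ [] j ω - X [] [j] ω) 0 := by
  simp only [coptAt, mem_argminNeighbors_root, pwitLength_child]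

omit [MeasurableSpace Ω] in
lemma pwitDecision_root_eq_iff {X : Word → Word → Ω → ℝ} {k : ℕ} {ω : Ω} :
    pwitDecision ξ X₀ k [] ω = coptAt ξ X [] ω ↔
      ∀ i, (∀ j, max (ξ [] i ω - pwitMessage ξ X₀ k [] [i] ω) 0 ≤
          max (ξ [] j ω - pwitMessage ξ X₀ k [] [j] ω) 0) ↔
        ∀ j, max (ξ [] i ω - X [] [i] ω) 0 ≤ max (ξ [] j ω - X [] [j] ω) 0 := by
  constructor
  · intro h i
    have := Set.ext_iff.1 h [i]
    simpa [mem_pwitDecision_root, mem_coptAt_root] using this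
  · intro h
    ext u
    simp only [mem_pwitDecision_root, mem_coptAt_root, h]

namespace IsPWIT

variable (hξ : IsPWIT P ξ) (hX : IsIIDInit P ξ ν X₀) (hν : ν (Set.Iio 0) = 0)

include hX hν in
omit [IsProbabilityMeasure P] in
lemma ae_isDownRecursion : ∀ᵐ ω ∂P, IsDownRecursion (fun v i => ξ v i ω)
    fun k v i => pwitMessage ξ X₀ k v (i :: v) ω :=
  (hX.ae_nonneg hν).mono fun _ hω => isDownRecursion_pwitMessage ξ hω

include hξ hX hν

lemma ae_tendsto_pwitMessage : ∀ᵐ ω ∂P, ∀ v i,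
    Tendsto (fun k => pwitMessage ξ X₀ k v (i :: v) ω) atTop (𝓝 (limitProcess ξ v (i :: v) ω)) := by
  filter_upwards [ae_isDownRecursion hX hν, hξ.ae_isSqueezed] with ω h1 h2 v i
  rw [limitProcess_child]
  exact h2.tendsto h1 v i

lemma memLp_pwitMessage {k : ℕ} (hk : 1 ≤ k) (v : Word) (i : ℕ) :
    MemLp (pwitMessage ξ X₀ k v (i :: v)) 2 P := by
  refine (hξ.memLp_zeroIter_one v i).mono
    (hX.measurable_pwitMessage (fun v => (hξ.poisson v).measurable) k v i).aestronglyMeasurable ?_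
  filter_upwards [ae_isDownRecursion hX hν] with ω h
  rw [Real.norm_of_nonneg (h.nonneg_iterate k v i),
    Real.norm_of_nonneg ((h.nonneg_iterate k v i).trans (h.le_zeroIter_one hk v i))]
  exact h.le_zeroIter_one hk v i

lemma tendsto_eLpNorm_pwitMessage_sub (v : Word) (i : ℕ) :
    Tendsto (fun k => eLpNorm (fun ω => pwitMessage ξ X₀ k v (i :: v) ω -
      limitProcess ξ v (i :: v) ω) 2 P) atTop (𝓝 0) :=
  hξ.tendsto_eLpNorm_sub
    (fun k => hX.measurable_pwitMessage (fun v => (hξ.poisson v).measurable) k v i)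
    (fun k => (ae_isDownRecursion hX hν).mono fun _ h => h.nonneg_iterate k v i)
    (fun _ hk => (ae_isDownRecursion hX hν).mono fun _ h => h.le_zeroIter_one hk v i)
    ((hξ.ae_tendsto_pwitMessage hX hν).mono fun _ h => h v i)

/-- Almost surely the decisions at the root are eventually optimal. -/
lemma ae_eventually_pwitDecision_eq : ∀ᵐ ω ∂P, ∀ᶠ k in atTop,
    pwitDecision ξ X₀ k [] ω = coptAt ξ (limitProcess ξ) [] ω := by
  have hmark : IsMarking P (ξ []) (fun j ω => zeroIter (fun w j => ξ w j ω) 1 [] j)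
      (tailCoeff 1) :=
    hξ.isMarking (fun j => measurable_zeroIter ξ 1 [] j) (hξ.map_zeroIter 1 [])
  filter_upwards [(hξ.poisson []).ae_tendsto_sub hmark (tailCoeff_mem 1).1 (tailCoeff_mem 1).2,
    (hξ.poisson []).ae_no_ties (hξ.isMarking_downLimit []), ae_isDownRecursion hX hν,
    hξ.ae_tendsto_pwitMessage hX hν] with ω hb htie hrec hlim
  simp only [← limitProcess_child] at htie
  have h := eventually_argmin_iff (s := fun k j => ξ [] j ω - pwitMessage ξ X₀ k [] [j] ω) hb
    ((eventually_ge_atTop 1).mono fun k hk j => sub_le_sub_left (hrec.le_zeroIter_one hk [] j) _)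
    (fun j => (hlim [] j).const_sub _) htie.1 htie.2
  exact h.mono fun k hk => pwitDecision_root_eq_iff.2 hk

lemma tendsto_measure_pwitDecision_ne :
    Tendsto (fun k => P {ω | pwitDecision ξ X₀ k [] ω ≠ coptAt ξ (limitProcess ξ) [] ω}) atTop
      (𝓝 0) := by
  have hm : ∀ k, MeasurableSet
      {ω | pwitDecision ξ X₀ k [] ω ≠ coptAt ξ (limitProcess ξ) [] ω} := fun k => by
    refine MeasurableSet.compl (s := {ω | pwitDecision ξ X₀ k [] ω =
      coptAt ξ (limitProcess ξ) [] ω}) ?_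
    simp only [pwitDecision_root_eq_iff, Set.ofPred_forall]
    have hlen := (hξ.poisson []).measurable
    refine MeasurableSet.iInter fun i => MeasurableSet.iff ?_ ?_
    · exact measurableSet_forall_max_le (a := fun j ω => ξ [] j ω - pwitMessage ξ X₀ k [] [j] ω)
        (fun j => (hlen j).sub
          (hX.measurable_pwitMessage (fun v => (hξ.poisson v).measurable) k [] j)) i
    · exact measurableSet_forall_max_le (a := fun j ω => ξ [] j ω - limitProcess ξ [] [j] ω)
        (fun j => (hlen j).sub
          ((measurable_limitProcess_child ξ [] j).mono (hξ.treeSigma_le _) le_rfl)) i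
  rw [← measure_empty (μ := P)]
  refine tendsto_measure_of_ae_tendsto_indicator_of_isFiniteMeasure atTop MeasurableSet.empty hm ?_
  filter_upwards [hξ.ae_eventually_pwitDecision_eq hX hν] with ω hω
  filter_upwards [hω] with k hk
  simp [hk]

end IsPWIT

end decision

end EdgeCoverBP

open EdgeCoverBP
theorem mainTheorem8 {Ω : Type*} [MeasurableSpace Ω] (P : Measure Ω) [IsProbabilityMeasure P]
    (ξ : Word → ℕ → Ω → ℝ) (hξ : IsPWIT P ξ) :
    ∃ X : Word → Word → Ω → ℝ,
      IsStationaryProcess P ξ X ∧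
      (∀ Y : Word → Word → Ω → ℝ, IsStationaryProcess P ξ Y →
        ∀ u v, wordTree.Adj u v → Y u v =ᵐ[P] X u v) ∧
      ∀ (ν : Measure ℝ) [IsProbabilityMeasure ν], ν (Set.Iio 0) = 0 →
        ∀ X₀ : Word → Word → Ω → ℝ, IsIIDInit P ξ ν X₀ →
          (∀ (v : Word) (i : ℕ),
            MemLp (X v (i :: v)) 2 P ∧
            (∀ k : ℕ, 1 ≤ k → MemLp (pwitMessage ξ X₀ k v (i :: v)) 2 P) ∧
            Tendsto (fun k : ℕ =>
              eLpNorm (fun ω => pwitMessage ξ X₀ k v (i :: v) ω - X v (i :: v) ω) 2 P)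
              atTop (𝓝 0)) ∧
          Tendsto (fun k : ℕ => P {ω | pwitDecision ξ X₀ k [] ω ≠ coptAt ξ X [] ω})
            atTop (𝓝 0) := by
  refine ⟨limitProcess ξ, hξ.isStationaryProcess_limitProcess,
    fun Y hY u v huv => hξ.ae_eq_limitProcess hY huv, fun ν _ hν X₀ hX => ⟨fun v i => ⟨?_,
      fun k hk => hξ.memLp_pwitMessage hX hν hk v i,
      hξ.tendsto_eLpNorm_pwitMessage_sub hX hν v i⟩, hξ.tendsto_measure_pwitDecision_ne hX hν⟩⟩
  exact hξ.memLp_limitProcess_child v i
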